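/- **Generalized soundness of front-end translations.** *IDF algebras.* An IDF algebra is a set with a partial commutative, associative addition $\oplus$, maps $|\cdot|$ (core), $\mathsf{stabilize}$, $\mathsf{unit}$ and a predicate $\mathsf{stable}$ such that, with $a\succeq b:\Leftrightarrow\exists r.\,a=b\oplus r$: $c=a\oplus b\wedge c=c\oplus c\Rightarrow a=a\oplus a$; $x=x\oplus|x|$; $|x|=|x|\oplus|x|$; $x=x\oplus c\Rightarrow|x|\succeq c$; $|a\oplus b|=|a|\oplus|b|$ and $\mathsf{stabilize}(a\oplus b)=\mathsf{stabilize}(a)\oplus\mathsf{stabilize}(b)$ whenever $a\oplus b$ is defined; $a=b\oplus x\wedge a=b\oplus y\wedge|x|=|y|\Rightarrow x=y$; $\mathsf{stable}(x)\Rightarrow x=\mathsf{stabilize}(x)$; $\mathsf{stable}(\mathsf{stabilize}(x))$; $x=\mathsf{stabilize}(x)\oplus|x|$; $a=b\oplus\mathsf{unit}(c)\Rightarrow a=b$; $a=a\oplus\mathsf{unit}(a)$; $|\mathsf{unit}(a)|=\mathsf{unit}(a)$; $\mathsf{stable}(\mathsf{unit}(a))$. A semantic assertion is a set $P$ of states.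 $P*Q=\{a\oplus b\mid a\in P,b\in Q\}$; $P$ is monotone if it is closed under going to $\succeq$-larger states, and $\overline P=\{x\mid\exists y\in P.\,x\succeq y\}$; $P$ is self-framing if $x\in P\Leftrightarrow\mathsf{stabilize}(x)\in P$; $B$ frames $P$ if $\{x\}*P$ is self-framing for every stable $x\in B$. A partial Boolean function $e$ is pure if $e(x)=e(|x|)$ for all $x$ (including definedness) and monotone if a defined value persists in $\succeq$-larger states; $P$ frames $e$ if $e$ is defined on $P$; $e$ is stable under $P$ if $e(x)=e(\mathsf{stabilize}(x))$ for all $x\in P$ (including definedness). Write $e$ and $\neg e$ also for the sets where $e$ is true, respectively false. *States.* Both languages use local variables from a set $\mathsf{Var}$. A type context $\Delta$ assigns types to the declared variables and has a heap component. A state is a pair of a store and a heap that is well-typed under $\Delta$ (the store defines exactly the declared variables, with values of the declared types); the heaps that are well-typed under a heap component form an IDF algebra, stores are added only if they are equal, and the other operations leave the store unchanged. All states are well-typed, and overwriting $\omega[v/x]$ is with well-typed values. $P$ is independent of $x$ if $\omega\in P\Leftrightarrow\omega[v/x]\in P$ for all $\omega,v$. *IVL.* Boolean expressions of the IVL are pure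 and monotone partial Boolean functions of states; assertions denote a set of states in each type context. Statements are $\mathsf{skip}$, $\mathsf{inhale}\,A$, $\mathsf{exhale}\,A$, $\mathsf{havoc}\,x$, $C_1;C_2$, $\mathsf{if}(b)\{C_1\}\{C_2\}$ and possibly further primitive statements with rules that are affine (a rule instance for self-framing $P,Q$ yields one for $\overline P,\overline Q$). The judgement $\Delta\vdash[P]\,C\,[Q]$ is inductively generated by: $[P]\,\mathsf{skip}\,[P]$; the rules of further primitives if $P$, $Q$ are self-framing; $[P]\,\mathsf{inhale}\,A\,[P*A]$ if $P$ frames $A$; $[P]\,\mathsf{exhale}\,A\,[Q]$ if $P\subseteq Q*A$ and $Q$ is self-framing; $[P]\,\mathsf{havoc}\,x\,[\exists x\in\Delta(x).\,P]$ if $\Delta(x)$ is defined; sequential composition; and $[P]\,\mathsf{if}(b)\{C_1\}\{C_2\}\,[B_1\cup B_2]$ if $P$ frames $b$, $[P*b]\,C_1\,[B_1]$ and $[P*\neg b]\,C_2\,[B_2]$; except in sequential composition, $P$ must always be self-framing. *Front-end.* A front-end supplies types, values with a type $\mathsf{tp}(v)$, ghost heaps, Boolean expressions $b$ with a partial valuation,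 input assertions $A_p$ with a set of satisfying states in each type context, primitive statements $C_p$ with a well-formedness predicate and CSL rules, and finite sets $\mathsf{fv}$ of free and $\mathsf{wr}$ of written variables. Assertions are $A::=A_p\mid b\mid A*A\mid A\vee A\mid b\Rightarrow A\mid\exists x{:}t.\,A$ with the standard interpretation $[\![A]\!]$ ($b\Rightarrow A$ requires $b$ to be defined), and statements are $c::=\mathsf{skip}\mid C_p\mid c;c\mid\mathsf{if}(b)\{c\}\{c\}\mid\mathsf{while}(b)\,\mathsf{inv}\,A\,\{c\}\mid\{A\}c\{A\}\,\|\,\{A\}c\{A\}$. Here $\mathsf{fv}$ and $\mathsf{wr}$ extend to assertions and statements in the usual way (annotations of loops and parallel branches do not contribute to $\mathsf{fv}$ of statements). A statement is well-formed under $\Delta$ if its parts are; for loops moreover $[\![A]\!]$ is self-framing and $b$ is stable under it; for $\{P_1\}c_1\{Q_1\}\|\{P_2\}c_2\{Q_2\}$ moreover all four annotations are self-framing and $\mathsf{wr}(c_i)\cap(\mathsf{fv}(c_j)\cup\mathsf{fv}(P_j)\cup\mathsf{fv}(Q_j))=\varnothing$ for $i\ne j$. The CSL judgement $\Delta\vdash\{P\}\,c\,\{Q\}$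 is inductively generated by: $\{P\}\mathsf{skip}\{P\}$ for self-framing $P$; the rules of primitive statements for self-framing $P,Q$; sequential composition; $\{P\}\mathsf{if}(b)\{c_1\}\{c_2\}\{B_1\cup B_2\}$ from $\{P\cap b\}c_1\{B_1\}$ and $\{P\cap\neg b\}c_2\{B_2\}$ if $P$ frames $b$; $\{P\}\mathsf{while}(b)\{c\}\{P\cap\neg b\}$ from $\{P\cap b\}c\{P\}$ if $P$ frames $b$ and $b$ is stable under $P$; $\{P_1*P_2\}\,c_1\|c_2\,\{Q_1*Q_2\}$ from $\{P_i\}c_i\{Q_i\}$ if $\mathsf{fv}(c_i)\cap\mathsf{wr}(c_j)=\varnothing$ and $P_i,Q_i$ are independent of all variables in $\mathsf{wr}(c_j)$ ($i\neq j$); the frame rule, from $\{P\}c\{Q\}$ to $\{P*R\}c\{Q*R\}$, for self-framing $R$ independent of $\mathsf{wr}(c)$; and consequence, with self-framing new pre- and postcondition. *Translation.* A translation consists of translations of types, values, heap components of type contexts, Boolean expressions, input assertions and primitive statements, a relation $\varphi\sim\Phi$ between front-end ghost heaps and IVL heaps, and, for each front-end type $t$, either nothing or a family of IVL Boolean expressions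 $\mathsf{haveinv}(t,x)$. States are related, $\omega\sim\Omega$, if the store of $\Omega$ is the pointwise value translation of the store of $\omega$ and the heaps are related. The assertion translation $\langle A\rangle$ is homomorphic, except that $\langle\exists x{:}t.A\rangle=\exists x{:}\langle t\rangle.\,\mathsf{haveinv}(t,x)*\langle A\rangle$ (without the first conjunct if $\mathsf{haveinv}(t,\cdot)$ is not given). The statement translation $\langle c\rangle=(C_m,C_e)$, with a main statement $C_m=\langle c\rangle_m$ and a set $C_e$ of auxiliary statements, is homomorphic on $\mathsf{skip}$, sequence and conditional and as given on primitives ($C_e$ collects those of the parts); the loop $\mathsf{while}(b)\,\mathsf{inv}\,I\,\{c\}$ becomes $\mathsf{exhale}\,\langle I\rangle*(\langle b\rangle\vee\neg\langle b\rangle);\ \mathsf{havoc}\,\mathsf{wr}(c);\ \mathsf{inhale}\,\langle I\rangle*\neg\langle b\rangle$, with the new auxiliary statement $\mathsf{inhale}\,\langle I\rangle*\langle b\rangle;\ \langle c\rangle_m;\ \mathsf{exhale}\,\langle I\rangle*(\langle b\rangle\vee\neg\langle b\rangle)$; and $\{P_1\}c_1\{Q_1\}\|\{P_2\}c_2\{Q_2\}$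 becomes $\mathsf{exhale}\,\langle P_1*P_2\rangle;\ \mathsf{havoc}\,(\mathsf{wr}(c_1)\cup\mathsf{wr}(c_2));\ \mathsf{inhale}\,\langle Q_1*Q_2\rangle$, with the new auxiliary statements $\mathsf{inhale}\,\langle P_i\rangle;\ \langle c_i\rangle_m;\ \mathsf{exhale}\,\langle Q_i\rangle$, $i=1,2$. For an IVL semantic assertion $P$ put $\mathcal B(P)=\{\omega\mid\exists\Omega\in P.\ \omega\sim\Omega\}$; $P$ is well-formed if $\mathcal B(P)=\{\omega\mid\forall\Omega.\ \omega\sim\Omega\Rightarrow\Omega\in P\}$. An assertion $A$ has generalized backward satisfiability if, whenever $\omega\sim\Omega$, $\Omega=\Omega_A\oplus\Omega_F$ and $\Omega_A$ satisfies $\langle A\rangle$, there are $\omega_A,\omega_F,\Omega_F'$ with $\omega=\omega_A\oplus\omega_F$, $\omega_A$ satisfies $A$, $\omega_F\sim\Omega_F'$ and $\Omega_F'\succeq\Omega_F$. *Requirements* (for all type contexts): 1. Front-end Boolean expressions are pure; values of Boolean expressions and satisfaction of input assertions do not depend on variables outside $\mathsf{fv}$; written variables of well-formed primitive statements are declared;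 if $\{P\}\,C_p\,\{Q\}$ then $\{\overline P\}\,C_p\,\{\overline Q\}$. 2. The value translation is injective and maps values of type $t$ to values of type $\langle t\rangle$. If $\mathsf{haveinv}(t,\cdot)$ is not given, every IVL value of type $\langle t\rangle$ is the translation of a front-end value of type $t$; otherwise, if $\Omega(x)=v$ has type $\langle t\rangle$, then $\mathsf{haveinv}(t,x)$ is true in $\Omega$ iff $v$ is the translation of a front-end value of type $t$. 3. If $\varphi=\varphi_1\oplus\varphi_2$ and $\varphi\sim\Phi$, then $\Phi=\Phi_1\oplus\Phi_2$ for some $\Phi_1,\Phi_2$ with $\varphi_1\sim\Phi_1$, $\varphi_2\sim\Phi_2$. If $\varphi\sim\Phi$ and $\varphi_0=\varphi\oplus\varphi_1$, there is $\Phi_1$ with $\varphi_1\sim\Phi_1$, $\Phi\oplus\Phi_1$ defined, and $\varphi_0\sim\Phi\oplus\Phi_1$. Every $\varphi$ is related to some $\Phi$. If $\varphi\sim\Phi$, then $\mathsf{stabilize}(\varphi)\sim\mathsf{stabilize}(\Phi)$. If $\mathsf{stabilize}(\varphi)\sim\Phi'$, there is $\Phi$ with $\mathsf{stabilize}(\Phi)=\mathsf{stabilize}(\Phi')$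 and $\varphi\sim\Phi$. 4. If $\omega\sim\Omega$, then $b(\omega)=\langle b\rangle(\Omega)$ (including definedness), and $\omega$ satisfies an input assertion $A_p$ iff $\Omega$ satisfies $\langle A_p\rangle$. Each $\langle A_p\rangle$ is monotone, and each $A_p$ has generalized backward satisfiability. 5. Assertions inhaled in the translation of a primitive statement are monotone. If $[P]\,\langle C_p\rangle\,[Q]$ in the IVL, with $P,Q$ monotone, then $\{\mathcal B(P)\}\,C_p\,\{\mathcal B(Q)\}$ in CSL. **Theorem.** Assume all these requirements. Then (i) $\langle A\rangle$ is well-formed for every front-end assertion $A$. (ii) Let $c$ be a statement that is well-formed under a type context $\Delta$, let $\langle c\rangle=(C_m,C_e)$, and let $P,Q$ be front-end assertions. If $\langle\Delta\rangle\vdash[\langle P\rangle]\,C_m\,[\langle Q\rangle]$, and for every $C\in C_e$ there is an IVL semantic assertion $Q_C$ with $\langle\Delta\rangle\vdash[\top]\,C\,[Q_C]$ ($\top$ the set of all states), then $\Delta\vdash\{[\![P]\!]\}\,c\,\{[\![Q]\!]\}$ holds in CSL. -/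

import Mathlib

universe u v w

namespace SLTrans

/-! ## IDF algebras and semantic assertions -/

/-- An algebra of implicit dynamic frames. The partial addition `a ⊕ b` is `oplus a b : Option S`,
with `none` meaning "undefined". -/
class IDFAlgebra (S : Type u) where
  oplus : S → S → Option S
  core : S → S
  stable : S → Prop
  stabilize : S → S
  unit : S → S
  oplus_comm : ∀ a b, oplus a b = oplus b a
  oplus_assoc : ∀ a b c,
    (oplus b c).bind (fun bc => oplus a bc) = (oplus a b).bind (fun ab => oplus ab c)
  positivity : ∀ a b c, oplus a b = some c → oplus c c = some c → oplus a a = some a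
  oplus_core : ∀ x, oplus x (core x) = some x
  core_idem : ∀ x, oplus (core x) (core x) = some (core x)
  core_max : ∀ x c, oplus x c = some x → ∃ r, oplus c r = some (core x)
  core_sum : ∀ a b c, oplus a b = some c → oplus (core a) (core b) = some (core c)
  cancel : ∀ a b x y, oplus b x = some a → oplus b y = some a → core x = core y → x = y
  stable_eq : ∀ x, stable x → x = stabilize x
  stable_stabilize : ∀ x, stable (stabilize x)
  stabilize_sum : ∀ a b c, oplus a b = some c →
    oplus (stabilize a) (stabilize b) = some (stabilize c)
  stabilize_core : ∀ x, oplus (stabilize x) (core x) = some x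
  unit_neutral : ∀ a b c, oplus b (unit c) = some a → a = b
  oplus_unit : ∀ a, oplus a (unit a) = some a
  core_unit : ∀ a, core (unit a) = unit a
  stable_unit : ∀ a, stable (unit a)

section Semantic

variable {S : Type u} [IDFAlgebra S]

open IDFAlgebra

/-- `a ⪰ b`. -/
def Ge (a b : S) : Prop := ∃ r, oplus b r = some a

/-- Separating conjunction of semantic assertions. -/
def sepConj (P Q : Set S) : Set S := {x | ∃ a ∈ P, ∃ b ∈ Q, oplus a b = some x}

def SelfFraming (P : Set S) : Prop := ∀ x, x ∈ P ↔ stabilize x ∈ P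

/-- The assertion `B` frames the assertion `P`: every stable state `x` of `B` makes
`{x} * P` self-framing. -/
def Frames (B P : Set S) : Prop := ∀ x ∈ B, stable x → SelfFraming (sepConj {x} P)

/-- `P` frames the expression `e`. -/
def FramesExpr (P : Set S) (e : S → Option Bool) : Prop := ∀ x ∈ P, (e x).isSome

/-- Where both are defined, the values of `e` at `x` and `stabilize x` agree, and one is defined
iff the other one is. -/
def StableUnder (e : S → Option Bool) (P : Set S) : Prop := ∀ x ∈ P, e x = e (stabilize x)

def IsMonotone (P : Set S) : Prop := ∀ x ∈ P, ∀ y, Ge y x → y ∈ P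

/-- The least monotone assertion that contains `P`. -/
def monotonize (P : Set S) : Set S := {x | ∃ y ∈ P, Ge x y}

/-- The states in which `e` is defined and has the value `b`. -/
def evalsTo (e : S → Option Bool) (b : Bool) : Set S := {x | e x = some b}

/-- A pure expression depends on the core of the state only. -/
def IsPure (e : S → Option Bool) : Prop := ∀ x, e x = e (core x)

/-- A defined value of a monotone expression persists in larger states. -/
def IsMonotoneExpr (e : S → Option Bool) : Prop :=
  ∀ x y b, e x = some b → Ge y x → e y = some b

end Semantic

/-! ## Well-typed states -/

/-- Types, values and heaps of a state model. `Heap γ` is the IDF algebra of those heaps that are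
well-typed under the heap part `γ` of a type context. -/
structure StateModel where
  Ty : Type u
  Val : Type u
  hasTy : Val → Ty → Prop
  HCtx : Type u
  Heap : HCtx → Type u
  [alg : ∀ γ, IDFAlgebra (Heap γ)]

attribute [instance] StateModel.alg

/-- Type contexts: types of the declared local variables, and a heap part. -/
structure Ctx (Var : Type w) (M : StateModel.{u}) where
  vars : Var → Option M.Ty
  heap : M.HCtx

/-- `Δ[x ↦ t]`. -/
def Ctx.set {Var : Type w} [DecidableEq Var] {M : StateModel.{u}} (Δ : Ctx Var M) (x : Var)
    (t : M.Ty) : Ctx Var M :=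
  ⟨Function.update Δ.vars x (some t), Δ.heap⟩

/-- States that are well-typed under `Δ`: the store defines exactly the declared variables, with
values of the declared types. -/
@[ext]
structure State {Var : Type w} {M : StateModel.{u}} (Δ : Ctx Var M) where
  store : Var → Option M.Val
  heap : M.Heap Δ.heap
  typed : ∀ x, Option.Rel M.hasTy (store x) (Δ.vars x)

section States

variable {Var : Type w} {M : StateModel.{u}}

open IDFAlgebra

open Classical in
/-- Stores are added only if they are equal; heaps are added in their own algebra. -/
noncomputable def State.oplus {Δ : Ctx Var M} (a b : State Δ) : Option (State Δ) :=
  if a.store = b.store then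
    (IDFAlgebra.oplus a.heap b.heap).map (fun h => ⟨a.store, h, a.typed⟩)
  else none

theorem State.oplus_eq_some {Δ : Ctx Var M} {a b c : State Δ} :
    State.oplus a b = some c ↔
      a.store = c.store ∧ b.store = c.store ∧ IDFAlgebra.oplus a.heap b.heap = some c.heap := by
  unfold State.oplus
  split_ifs with h
  · rw [Option.map_eq_some_iff]
    constructor
    · rintro ⟨k, hk, rfl⟩
      exact ⟨rfl, h.symm, hk⟩
    · rintro ⟨h1, -, h3⟩
      exact ⟨c.heap, h3, State.ext h1 rfl⟩
  · simp only [false_iff]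
    rintro ⟨h1, h2, -⟩
    exact h (h1.trans h2.symm)

/-- Replace the heap of a state. -/
def State.withHeap {Δ : Ctx Var M} (a : State Δ) (h : M.Heap Δ.heap) : State Δ :=
  ⟨a.store, h, a.typed⟩

noncomputable instance {Δ : Ctx Var M} : IDFAlgebra (State Δ) where
  oplus := State.oplus
  core a := a.withHeap (core a.heap)
  stable a := stable a.heap
  stabilize a := a.withHeap (stabilize a.heap)
  unit a := a.withHeap (unit a.heap)
  oplus_comm a b := by
    ext1 c
    simp only [State.oplus_eq_some]
    rw [IDFAlgebra.oplus_comm a.heap b.heap]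
    tauto
  oplus_assoc a b c := by
    ext1 d
    simp only [Option.bind_eq_some_iff, State.oplus_eq_some]
    have key := IDFAlgebra.oplus_assoc a.heap b.heap c.heap
    constructor
    · rintro ⟨x, ⟨h1, h2, h3⟩, h4, h5, h6⟩
      have : (IDFAlgebra.oplus a.heap b.heap).bind
          (fun ab => IDFAlgebra.oplus ab c.heap) = some d.heap := by
        rw [← key, Option.bind_eq_some_iff]
        exact ⟨_, h3, h6⟩
      obtain ⟨y, hy1, hy2⟩ := Option.bind_eq_some_iff.1 this
      exact ⟨a.withHeap y, ⟨rfl, (h1.trans h5).trans h4.symm, hy1⟩, h4, h2.trans h5, hy2⟩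
    · rintro ⟨x, ⟨h1, h2, h3⟩, h4, h5, h6⟩
      have : (IDFAlgebra.oplus b.heap c.heap).bind
          (fun bc => IDFAlgebra.oplus a.heap bc) = some d.heap := by
        rw [key, Option.bind_eq_some_iff]
        exact ⟨_, h3, h6⟩
      obtain ⟨y, hy1, hy2⟩ := Option.bind_eq_some_iff.1 this
      exact ⟨b.withHeap y, ⟨rfl, h5.trans (h2.trans h4).symm, hy1⟩, h1.trans h4,
        h2.trans h4, hy2⟩
  positivity a b c h1 h2 := by
    rw [State.oplus_eq_some] at *
    exact ⟨rfl, rfl, positivity _ _ _ h1.2.2 h2.2.2⟩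
  oplus_core x := State.oplus_eq_some.2 ⟨rfl, rfl, oplus_core _⟩
  core_idem x := State.oplus_eq_some.2 ⟨rfl, rfl, core_idem _⟩
  core_max x c h := by
    rw [State.oplus_eq_some] at h
    obtain ⟨r, hr⟩ := core_max _ _ h.2.2
    exact ⟨x.withHeap r, State.oplus_eq_some.2 ⟨h.2.1, rfl, hr⟩⟩
  core_sum a b c h := by
    rw [State.oplus_eq_some] at *
    exact ⟨h.1, h.2.1, core_sum _ _ _ h.2.2⟩
  cancel a b x y h1 h2 h3 := by
    rw [State.oplus_eq_some] at *
    have h4 : core x.heap = core y.heap := congrArg State.heap h3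
    exact State.ext (h1.2.1.trans h2.2.1.symm)
      (cancel _ _ _ _ h1.2.2 h2.2.2 h4)
  stable_eq x h := State.ext rfl (stable_eq _ h)
  stable_stabilize x := stable_stabilize x.heap
  stabilize_sum a b c h := by
    rw [State.oplus_eq_some] at *
    exact ⟨h.1, h.2.1, stabilize_sum _ _ _ h.2.2⟩
  stabilize_core x := State.oplus_eq_some.2 ⟨rfl, rfl, stabilize_core _⟩
  unit_neutral a b c h := by
    rw [State.oplus_eq_some] at h
    exact State.ext h.1.symm (unit_neutral _ _ _ h.2.2)
  oplus_unit a := State.oplus_eq_some.2 ⟨rfl, rfl, oplus_unit _⟩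
  core_unit a := State.ext rfl (core_unit a.heap)
  stable_unit a := stable_unit a.heap

variable [DecidableEq Var]

/-- `b = a[v/x]`, where `a` and `b` may be typed in contexts that differ in the variables. -/
def IsUpd {vars vars' : Var → Option M.Ty} {γ : M.HCtx} (a : State (⟨vars, γ⟩ : Ctx Var M))
    (x : Var) (v : M.Val) (b : State (⟨vars', γ⟩ : Ctx Var M)) : Prop :=
  b.store = Function.update a.store x (some v) ∧ b.heap = a.heap

/-- `∃ x : t. P`, for a set `P` of states in which `x` has the type `t`. -/
def existsVar {Δ : Ctx Var M} (x : Var) (t : M.Ty) (P : Set (State (Δ.set x t))) :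
    Set (State Δ) :=
  {a | ∃ v, M.hasTy v t ∧ ∃ b ∈ P, IsUpd a x v b}

/-- `P` is independent of the variable `x`: overwriting `x` by a well-typed value does not matter. -/
def Independent {Δ : Ctx Var M} (P : Set (State Δ)) (x : Var) : Prop :=
  ∀ (a b : State Δ) (v : M.Val), IsUpd a x v b → (a ∈ P ↔ b ∈ P)

end States

/-! ## The intermediate verification language -/

/-- An intermediate verification language (IVL): its state model and its primitive statements
besides `inhale`, `exhale` and `havoc` (for instance assignments), with their axiomatic rules.
The rules are affine: they can be weakened to the monotone closures. -/
structure IVL (Var : Type w) where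
  M : StateModel.{v}
  Prim : Type v
  primRule : ∀ Δ : Ctx Var M, Set (State Δ) → Prim → Set (State Δ) → Prop
  primRule_affine : ∀ Δ P c Q, SelfFraming P → SelfFraming Q → primRule Δ P c Q →
    primRule Δ (monotonize P) c (monotonize Q)

namespace IVL

variable {Var : Type w}

/-- Boolean expressions of the IVL, given by their partial valuation; they are pure and
monotone. -/
structure BExp (V : IVL.{v, w} Var) where
  eval : ∀ {Δ : Ctx Var V.M}, State Δ → Option Bool
  pure : ∀ Δ : Ctx Var V.M, IsPure (eval (Δ := Δ))
  mono : ∀ Δ : Ctx Var V.M, IsMonotoneExpr (eval (Δ := Δ))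

def BExp.not {V : IVL.{v, w} Var} (b : V.BExp) : V.BExp where
  eval a := (b.eval a).map Bool.not
  pure Δ a := congrArg (Option.map Bool.not) (b.pure Δ a)
  mono Δ x y c h hg := by
    obtain ⟨d, hd, rfl⟩ := Option.map_eq_some_iff.1 h
    simp [b.mono Δ x y d hd hg]

/-- Assertions of the IVL, given by the set of satisfying states in each type context. -/
def Assn (V : IVL.{v, w} Var) : Type (max v w) := ∀ Δ : Ctx Var V.M, Set (State Δ)

namespace Assn

variable {V : IVL.{v, w} Var}

/-- A Boolean expression, used as an assertion. -/
def bool (b : V.BExp) : V.Assn := fun _ => evalsTo b.eval true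

def sep (A B : V.Assn) : V.Assn := fun Δ => sepConj (A Δ) (B Δ)

def or (A B : V.Assn) : V.Assn := fun Δ => A Δ ∪ B Δ

def imp (b : V.BExp) (A : V.Assn) : V.Assn :=
  fun Δ => {a | (b.eval a).isSome ∧ (b.eval a = some true → a ∈ A Δ)}

def ex [DecidableEq Var] (x : Var) (t : V.M.Ty) (A : V.Assn) : V.Assn :=
  fun Δ => existsVar x t (A (Δ.set x t))

end Assn

inductive Stmt (V : IVL.{v, w} Var) : Type (max v w)
  | skip : Stmt V
  | prim (c : V.Prim) : Stmt V
  | inhale (A : V.Assn) : Stmt V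
  | exhale (A : V.Assn) : Stmt V
  | havoc (x : Var) : Stmt V
  | seq (c₁ c₂ : Stmt V) : Stmt V
  | ite (b : V.BExp) (c₁ c₂ : Stmt V) : Stmt V

/-- `havoc x₁; …; havoc xₙ`. -/
def Stmt.havocs {V : IVL.{v, w} Var} : List Var → V.Stmt
  | [] => .skip
  | x :: xs => .seq (.havoc x) (havocs xs)

/-- All assertions that are inhaled in the statement are monotone in the type context `Δ`. -/
def Stmt.InhalesMonotone {V : IVL.{v, w} Var} (Δ : Ctx Var V.M) : V.Stmt → Prop
  | .inhale A => IsMonotone (A Δ)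
  | .seq c₁ c₂ => c₁.InhalesMonotone Δ ∧ c₂.InhalesMonotone Δ
  | .ite _ c₁ c₂ => c₁.InhalesMonotone Δ ∧ c₂.InhalesMonotone Δ
  | _ => True

/-- The axiomatic semantics `Δ ⊢ [P] C [Q]` of the IVL. -/
inductive Ax [DecidableEq Var] (V : IVL.{v, w} Var) (Δ : Ctx Var V.M) :
    Set (State Δ) → V.Stmt → Set (State Δ) → Prop
  | skip (P : Set (State Δ)) : SelfFraming P → Ax V Δ P .skip P
  | prim (P Q : Set (State Δ)) (c : V.Prim) : SelfFraming P → SelfFraming Q →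
      V.primRule Δ P c Q → Ax V Δ P (.prim c) Q
  | inhale (P : Set (State Δ)) (A : V.Assn) : SelfFraming P → Frames P (A Δ) →
      Ax V Δ P (.inhale A) (sepConj P (A Δ))
  | exhale (P Q : Set (State Δ)) (A : V.Assn) : SelfFraming P → P ⊆ sepConj Q (A Δ) →
      SelfFraming Q → Ax V Δ P (.exhale A) Q
  | havoc (P : Set (State Δ)) (x : Var) (t : V.M.Ty) : SelfFraming P → Δ.vars x = some t →
      Ax V Δ P (.havoc x) {a | ∃ v, V.M.hasTy v t ∧ ∃ b ∈ P, IsUpd a x v b}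
  | seq (P R Q : Set (State Δ)) (c₁ c₂ : V.Stmt) : Ax V Δ P c₁ R → Ax V Δ R c₂ Q →
      Ax V Δ P (.seq c₁ c₂) Q
  | ite (P B₁ B₂ : Set (State Δ)) (b : V.BExp) (c₁ c₂ : V.Stmt) : SelfFraming P →
      FramesExpr P b.eval →
      Ax V Δ (sepConj P (evalsTo b.eval true)) c₁ B₁ →
      Ax V Δ (sepConj P (evalsTo b.not.eval true)) c₂ B₂ →
      Ax V Δ P (.ite b c₁ c₂) (B₁ ∪ B₂)

end IVL

/-! ## The front-end -/

/-- The input language of a front-end. Values have exactly one type, heaps are ghost heaps. -/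
structure FrontEnd (Var : Type w) where
  M : StateModel.{u}
  tp : M.Val → M.Ty
  hasTy_iff : ∀ v t, M.hasTy v t ↔ tp v = t
  /-- Boolean expressions. -/
  BE : Type u
  evalBE : BE → ∀ {Δ : Ctx Var M}, State Δ → Option Bool
  fvBE : BE → Finset Var
  /-- Input assertions. -/
  Inp : Type u
  satInp : Inp → ∀ Δ : Ctx Var M, Set (State Δ)
  fvInp : Inp → Finset Var
  /-- Primitive statements. -/
  Prim : Type u
  wfPrim : Ctx Var M → Prim → Prop
  cslPrim : ∀ Δ : Ctx Var M, Set (State Δ) → Prim → Set (State Δ) → Prop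
  wrPrim : Prim → Finset Var
  fvPrim : Prim → Finset Var

namespace FrontEnd

variable {Var : Type w}

inductive Assn (F : FrontEnd.{u, w} Var) : Type (max u w)
  | inp (A : F.Inp) : Assn F
  | bool (b : F.BE) : Assn F
  | sep (A B : Assn F) : Assn F
  | or (A B : Assn F) : Assn F
  | imp (b : F.BE) (A : Assn F) : Assn F
  | ex (x : Var) (t : F.M.Ty) (A : Assn F) : Assn F

inductive Stmt (F : FrontEnd.{u, w} Var) : Type (max u w)
  | skip : Stmt F
  | prim (c : F.Prim) : Stmt F
  | seq (c₁ c₂ : Stmt F) : Stmt F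
  | ite (b : F.BE) (c₁ c₂ : Stmt F) : Stmt F
  | while (b : F.BE) (I : F.Assn) (c : Stmt F) : Stmt F
  | par (P₁ : F.Assn) (c₁ : Stmt F) (Q₁ : F.Assn) (P₂ : F.Assn) (c₂ : Stmt F) (Q₂ : F.Assn) :
      Stmt F

variable {F : FrontEnd.{u, w} Var} [DecidableEq Var]

/-- The states that satisfy an assertion in a type context. -/
def Assn.sat : F.Assn → ∀ Δ : Ctx Var F.M, Set (State Δ)
  | .inp A, Δ => F.satInp A Δ
  | .bool b, _ => evalsTo (F.evalBE b) true
  | .sep A B, Δ => sepConj (A.sat Δ) (B.sat Δ)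
  | .or A B, Δ => A.sat Δ ∪ B.sat Δ
  | .imp b A, Δ => {a | (F.evalBE b a).isSome ∧ (F.evalBE b a = some true → a ∈ A.sat Δ)}
  | .ex x t A, Δ => existsVar x t (A.sat (Δ.set x t))

def Assn.fv : F.Assn → Finset Var
  | .inp A => F.fvInp A
  | .bool b => F.fvBE b
  | .sep A B => A.fv ∪ B.fv
  | .or A B => A.fv ∪ B.fv
  | .imp b A => F.fvBE b ∪ A.fv
  | .ex x _ A => A.fv.erase x

/-- Free variables. -/
def Stmt.fv : F.Stmt → Finset Var
  | .skip => ∅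
  | .prim c => F.fvPrim c
  | .seq c₁ c₂ => c₁.fv ∪ c₂.fv
  | .ite b c₁ c₂ => F.fvBE b ∪ c₁.fv ∪ c₂.fv
  | .while b _ c => F.fvBE b ∪ c.fv
  | .par _ c₁ _ _ c₂ _ => c₁.fv ∪ c₂.fv

/-- Written variables. -/
def Stmt.wr : F.Stmt → Finset Var
  | .skip => ∅
  | .prim c => F.wrPrim c
  | .seq c₁ c₂ => c₁.wr ∪ c₂.wr
  | .ite _ c₁ c₂ => c₁.wr ∪ c₂.wr
  | .while _ _ c => c.wr
  | .par _ c₁ _ _ c₂ _ => c₁.wr ∪ c₂.wr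

/-- Well-formedness of statements in a type context. -/
def Stmt.WF (Δ : Ctx Var F.M) : F.Stmt → Prop
  | .skip => True
  | .prim c => F.wfPrim Δ c
  | .seq c₁ c₂ => c₁.WF Δ ∧ c₂.WF Δ
  | .ite _ c₁ c₂ => c₁.WF Δ ∧ c₂.WF Δ
  | .while b I c => c.WF Δ ∧ SelfFraming (I.sat Δ) ∧ StableUnder (F.evalBE b) (I.sat Δ)
  | .par P₁ c₁ Q₁ P₂ c₂ Q₂ => c₁.WF Δ ∧ c₂.WF Δ ∧
      SelfFraming (P₁.sat Δ) ∧ SelfFraming (Q₁.sat Δ) ∧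
      SelfFraming (P₂.sat Δ) ∧ SelfFraming (Q₂.sat Δ) ∧
      c₁.wr ∩ (c₂.fv ∪ P₂.fv ∪ Q₂.fv) = ∅ ∧
      c₂.wr ∩ (c₁.fv ∪ P₁.fv ∪ Q₁.fv) = ∅

/-- The concurrent separation logic `Δ ⊢ {P} c {Q}` of the front-end. -/
inductive CSL (F : FrontEnd.{u, w} Var) (Δ : Ctx Var F.M) :
    Set (State Δ) → F.Stmt → Set (State Δ) → Prop
  | skip (P : Set (State Δ)) : SelfFraming P → CSL F Δ P .skip P
  | prim (P Q : Set (State Δ)) (c : F.Prim) : SelfFraming P → SelfFraming Q →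
      F.cslPrim Δ P c Q → CSL F Δ P (.prim c) Q
  | seq (P R Q : Set (State Δ)) (c₁ c₂ : F.Stmt) : CSL F Δ P c₁ R → CSL F Δ R c₂ Q →
      CSL F Δ P (.seq c₁ c₂) Q
  | ite (A B₁ B₂ : Set (State Δ)) (b : F.BE) (c₁ c₂ : F.Stmt) : FramesExpr A (F.evalBE b) →
      CSL F Δ (A ∩ evalsTo (F.evalBE b) true) c₁ B₁ →
      CSL F Δ (A ∩ evalsTo (F.evalBE b) false) c₂ B₂ →
      CSL F Δ A (.ite b c₁ c₂) (B₁ ∪ B₂)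
  | while (P : Set (State Δ)) (b : F.BE) (I : F.Assn) (c : F.Stmt) :
      FramesExpr P (F.evalBE b) → StableUnder (F.evalBE b) P →
      CSL F Δ (P ∩ evalsTo (F.evalBE b) true) c P →
      CSL F Δ P (.while b I c) (P ∩ evalsTo (F.evalBE b) false)
  | par (P₁ Q₁ P₂ Q₂ : Set (State Δ)) (A₁ B₁ A₂ B₂ : F.Assn) (c₁ c₂ : F.Stmt) :
      CSL F Δ P₁ c₁ Q₁ → CSL F Δ P₂ c₂ Q₂ →
      c₁.fv ∩ c₂.wr = ∅ → c₂.fv ∩ c₁.wr = ∅ →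
      (∀ x ∈ c₂.wr, Independent P₁ x ∧ Independent Q₁ x) →
      (∀ x ∈ c₁.wr, Independent P₂ x ∧ Independent Q₂ x) →
      CSL F Δ (sepConj P₁ P₂) (.par A₁ c₁ B₁ A₂ c₂ B₂) (sepConj Q₁ Q₂)
  | frame (P Q R : Set (State Δ)) (c : F.Stmt) : CSL F Δ P c Q → SelfFraming R →
      (∀ x ∈ c.wr, Independent R x) → CSL F Δ (sepConj P R) c (sepConj Q R)
  | conseq (P P' Q Q' : Set (State Δ)) (c : F.Stmt) : CSL F Δ P c Q → P' ⊆ P → Q ⊆ Q' →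
      SelfFraming P' → SelfFraming Q' → CSL F Δ P' c Q'

end FrontEnd

/-! ## The translation -/

/-- The data of a front-end translation whose state encoding is a relation. -/
structure Translation {Var : Type w} (F : FrontEnd.{u, w} Var) (V : IVL.{v, w} Var) where
  trTy : F.M.Ty → V.M.Ty
  trVal : F.M.Val → V.M.Val
  trHCtx : F.M.HCtx → V.M.HCtx
  /-- `relH φ Φ`: the IVL heap `Φ` is one of the possible encodings of the ghost heap `φ`. -/
  relH : ∀ {γ : F.M.HCtx}, F.M.Heap γ → V.M.Heap (trHCtx γ) → Prop
  trBE : F.BE → V.BExp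
  trInp : F.Inp → V.Assn
  trPrim : F.Prim → V.Stmt
  /-- `haveInv t = some e`: in the IVL, `e x` says that the value of `x` is the translation of a
  front-end value of type `t`. `haveInv t = none`: no such condition is needed. -/
  haveInv : F.M.Ty → Option (Var → V.BExp)

namespace Translation

variable {Var : Type w} {F : FrontEnd.{u, w} Var} {V : IVL.{v, w} Var}

/-- Translation of type contexts. -/
def trCtx (T : Translation F V) (Δ : Ctx Var F.M) : Ctx Var V.M :=
  ⟨fun x => (Δ.vars x).map T.trTy, T.trHCtx Δ.heap⟩

/-- The state encoding: the stores correspond by `trVal`, and the heaps are related. -/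
def relS (T : Translation F V) {Δ : Ctx Var F.M} (a : State Δ) (A : State (T.trCtx Δ)) : Prop :=
  A.store = (fun x => (a.store x).map T.trVal) ∧ T.relH a.heap A.heap

/-- The backward translation of an IVL semantic assertion. -/
def btr (T : Translation F V) {Δ : Ctx Var F.M} (P : Set (State (T.trCtx Δ))) : Set (State Δ) :=
  {a | ∃ A ∈ P, T.relS a A}

/-- Well-formed IVL semantic assertions. -/
def WellFormed (T : Translation F V) {Δ : Ctx Var F.M} (P : Set (State (T.trCtx Δ))) : Prop :=
  T.btr P = {a | ∀ A, T.relS a A → A ∈ P}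

variable [DecidableEq Var]

/-- Translation of assertions. -/
def trAssn (T : Translation F V) : F.Assn → V.Assn
  | .inp A => T.trInp A
  | .bool b => .bool (T.trBE b)
  | .sep A B => .sep (T.trAssn A) (T.trAssn B)
  | .or A B => .or (T.trAssn A) (T.trAssn B)
  | .imp b A => .imp (T.trBE b) (T.trAssn A)
  | .ex x t A => .ex x (T.trTy t)
      (match T.haveInv t with
        | none => T.trAssn A
        | some e => .sep (.bool (e x)) (T.trAssn A))

/-- `b ∨ ¬ b`: the evaluation of `b` succeeds. -/
def defd (b : V.BExp) : V.Assn := .or (.bool b) (.bool b.not)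

/-- Translation of statements: the main IVL statement and the set of auxiliary ones. -/
noncomputable def trStmt (T : Translation F V) : F.Stmt → V.Stmt × Set V.Stmt
  | .skip => (.skip, ∅)
  | .prim c => (T.trPrim c, ∅)
  | .seq c₁ c₂ => (.seq (T.trStmt c₁).1 (T.trStmt c₂).1, (T.trStmt c₁).2 ∪ (T.trStmt c₂).2)
  | .ite b c₁ c₂ =>
      (.ite (T.trBE b) (T.trStmt c₁).1 (T.trStmt c₂).1, (T.trStmt c₁).2 ∪ (T.trStmt c₂).2)
  | .while b I c =>
      (.seq (.exhale (.sep (T.trAssn I) (defd (T.trBE b))))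
        (.seq (.havocs c.wr.toList)
          (.inhale (.sep (T.trAssn I) (.bool (T.trBE b).not)))),
       {.seq (.inhale (.sep (T.trAssn I) (.bool (T.trBE b))))
          (.seq (T.trStmt c).1
            (.exhale (.sep (T.trAssn I) (defd (T.trBE b)))))} ∪ (T.trStmt c).2)
  | .par P₁ c₁ Q₁ P₂ c₂ Q₂ =>
      (.seq (.exhale (T.trAssn (.sep P₁ P₂)))
        (.seq (.havocs (c₁.wr ∪ c₂.wr).toList)
          (.inhale (T.trAssn (.sep Q₁ Q₂)))),
       {.seq (.inhale (T.trAssn P₁)) (.seq (T.trStmt c₁).1 (.exhale (T.trAssn Q₁)))} ∪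
       {.seq (.inhale (T.trAssn P₂)) (.seq (T.trStmt c₂).1 (.exhale (T.trAssn Q₂)))} ∪
       (T.trStmt c₁).2 ∪ (T.trStmt c₂).2)

/-- Generalized backward satisfiability of a front-end assertion, given by its satisfying states
`A`, with respect to its translation `A'`. -/
def GenBackwardSat (T : Translation F V) (A : ∀ Δ : Ctx Var F.M, Set (State Δ)) (A' : V.Assn) :
    Prop :=
  ∀ (Δ : Ctx Var F.M) (ω : State Δ) (Ω ΩA ΩF : State (T.trCtx Δ)),
    T.relS ω Ω → IDFAlgebra.oplus ΩA ΩF = some Ω → ΩA ∈ A' (T.trCtx Δ) →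
    ∃ (ωA ωF : State Δ) (ΩF' : State (T.trCtx Δ)),
      IDFAlgebra.oplus ωA ωF = some ω ∧ ωA ∈ A Δ ∧ T.relS ωF ΩF' ∧ Ge ΩF' ΩF

open IDFAlgebra in
/-- The adapted requirements of the generalized framework. -/
structure Requirements (T : Translation F V) : Prop where
  /- The front-end components. -/
  be_pure : ∀ b (Δ : Ctx Var F.M), IsPure (F.evalBE b (Δ := Δ))
  be_fv : ∀ b (Δ : Ctx Var F.M) (x : Var), x ∉ F.fvBE b → ∀ (ω ω' : State Δ) v,
    IsUpd ω x v ω' → F.evalBE b ω = F.evalBE b ω'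
  inp_fv : ∀ A (Δ : Ctx Var F.M) (x : Var), x ∉ F.fvInp A → Independent (F.satInp A Δ) x
  prim_wr : ∀ c (Δ : Ctx Var F.M), F.wfPrim Δ c → ∀ x ∈ F.wrPrim c, (Δ.vars x).isSome
  prim_affine : ∀ c (Δ : Ctx Var F.M) (P Q : Set (State Δ)), F.CSL Δ P (.prim c) Q →
    F.CSL Δ (monotonize P) (.prim c) (monotonize Q)
  /- Types and values. -/
  trVal_typed : ∀ v t, F.tp v = t → V.M.hasTy (T.trVal v) (T.trTy t)
  trVal_inj : Function.Injective T.trVal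
  haveInv_none : ∀ t, T.haveInv t = none → ∀ v, V.M.hasTy v (T.trTy t) →
    ∃ v₀, F.tp v₀ = t ∧ T.trVal v₀ = v
  haveInv_some : ∀ t e, T.haveInv t = some e → ∀ (x : Var) (Δ : Ctx Var V.M) (Ω : State Δ) v,
    Ω.store x = some v → V.M.hasTy v (T.trTy t) →
    ((e x).eval Ω = some true ↔ ∃ v₀, F.tp v₀ = t ∧ T.trVal v₀ = v)
  /- The encoding of heaps. -/
  relH_split : ∀ γ (φ φ₁ φ₂ : F.M.Heap γ) (Φ : V.M.Heap (T.trHCtx γ)),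
    oplus φ₁ φ₂ = some φ → T.relH φ Φ →
    ∃ Φ₁ Φ₂, oplus Φ₁ Φ₂ = some Φ ∧ T.relH φ₁ Φ₁ ∧ T.relH φ₂ Φ₂
  relH_extend : ∀ γ (φ φ₁ φ₀ : F.M.Heap γ) (Φ : V.M.Heap (T.trHCtx γ)),
    T.relH φ Φ → oplus φ φ₁ = some φ₀ →
    ∃ Φ₁ Φ₀, T.relH φ₁ Φ₁ ∧ oplus Φ Φ₁ = some Φ₀ ∧ T.relH φ₀ Φ₀
  relH_total : ∀ γ (φ : F.M.Heap γ), ∃ Φ, T.relH φ Φ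
  relH_stabilize : ∀ γ (φ : F.M.Heap γ) Φ, T.relH φ Φ → T.relH (stabilize φ) (stabilize Φ)
  relH_unstabilize : ∀ γ (φ : F.M.Heap γ) Φ', T.relH (stabilize φ) Φ' →
    ∃ Φ, stabilize Φ = stabilize Φ' ∧ T.relH φ Φ
  /- The translation of Boolean expressions. -/
  trBE_sem : ∀ b (Δ : Ctx Var F.M) (ω : State Δ) (Ω : State (T.trCtx Δ)), T.relS ω Ω →
    F.evalBE b ω = (T.trBE b).eval Ω
  /- The translation of input assertions. -/
  trInp_sem : ∀ A (Δ : Ctx Var F.M) (ω : State Δ) (Ω : State (T.trCtx Δ)), T.relS ω Ω →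
    (ω ∈ F.satInp A Δ ↔ Ω ∈ T.trInp A (T.trCtx Δ))
  trInp_mono : ∀ A (Δ : Ctx Var F.M), IsMonotone (T.trInp A (T.trCtx Δ))
  trInp_gbs : ∀ A, T.GenBackwardSat (F.satInp A) (T.trInp A)
  /- The translation of primitive statements. -/
  trPrim_inhale : ∀ c (Δ : Ctx Var F.M), (T.trPrim c).InhalesMonotone (T.trCtx Δ)
  trPrim_sem : ∀ c (Δ : Ctx Var F.M) (P Q : Set (State (T.trCtx Δ))), IsMonotone P →
    IsMonotone Q → V.Ax (T.trCtx Δ) P (T.trPrim c) Q → F.CSL Δ (T.btr P) (.prim c) (T.btr Q)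

end Translation

end SLTrans

open SLTrans

/-! The theorem is an induction over the front-end statement, carried out for arbitrary monotone IVL
assertions: if `P` and `Q` are monotone and the IVL proves `[P] ⟨c⟩ [Q]`, then CSL proves `{B(P)} c
{B(Q)}`, where `B` is `btr` (`Requirements.csl_btr`). For translated assertions `B(⟨A⟩) = ⟦A⟧`,
which gives the theorem.

On the side of assertions, three properties are proved together by induction (`Encodes.trAssn`):
related states agree on satisfaction, the translation is monotone, and generalized backward
satisfiability holds. They cannot be separated. A split of an IVL state need not come from a split
of the front-end state, so agreement on a separating conjunction needs backward satisfiability of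
one conjunct; this returns a remainder whose encoding is only larger than expected, so it needs
monotonicity of the other. Agreement and totality of the encoding give well-formedness.

On the side of statements, intermediate IVL assertions need not be monotone. Since the rules are
affine and all inhaled assertions are monotone, every assertion in a triple can be replaced by its
monotone closure (`Ax.monotonize`), and the induction applies to the parts.

Loops and parallel compositions share one pattern. The auxiliary statements yield a CSL triple `{A}
c {B}` for the annotations (`csl_of_inhale_exhale`). The main statement exhales `A`, havocs the
written variables and inhales `B`: what remains after the exhale and the havocs is a frame
independent of these variables, so the CSL frame rule extends the triple to `B(P)` and `B(Q)`
(`csl_of_exhale_havocs_inhale`). -/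

namespace SLTrans

/-! ## Algebra of semantic assertions -/

section Algebra

variable {S : Type u} [IDFAlgebra S]

open IDFAlgebra

theorem oplus_assoc_right {a b c ab d : S} (h₁ : oplus a b = some ab) (h₂ : oplus ab c = some d) :
    ∃ bc, oplus b c = some bc ∧ oplus a bc = some d := by
  have h := IDFAlgebra.oplus_assoc a b c
  rw [h₁, Option.bind_some, h₂] at h
  exact Option.bind_eq_some_iff.1 h

theorem oplus_assoc_left {a b c bc d : S} (h₁ : oplus b c = some bc) (h₂ : oplus a bc = some d) :
    ∃ ab, oplus a b = some ab ∧ oplus ab c = some d := by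
  have h := IDFAlgebra.oplus_assoc a b c
  rw [h₁, Option.bind_some, h₂] at h
  exact Option.bind_eq_some_iff.1 h.symm

theorem oplus_swap {a b c : S} (h : oplus a b = some c) : oplus b a = some c := by
  rw [IDFAlgebra.oplus_comm, h]

/-- `(a ⊕ b) ⊕ c = (a ⊕ c) ⊕ b`. -/
theorem oplus_right_comm {a b c ab d : S} (h₁ : oplus a b = some ab) (h₂ : oplus ab c = some d) :
    ∃ ac, oplus a c = some ac ∧ oplus ac b = some d := by
  obtain ⟨bc, h₃, h₄⟩ := oplus_assoc_right h₁ h₂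
  exact oplus_assoc_left (oplus_swap h₃) h₄

theorem ge_refl (a : S) : Ge a a := ⟨_, oplus_core a⟩

theorem ge_left {a b c : S} (h : oplus a b = some c) : Ge c a := ⟨_, h⟩

theorem ge_right {a b c : S} (h : oplus a b = some c) : Ge c b := ⟨_, oplus_swap h⟩

theorem Ge.trans {a b c : S} (h₁ : Ge a b) (h₂ : Ge b c) : Ge a c := by
  obtain ⟨r, hr⟩ := h₁
  obtain ⟨s, hs⟩ := h₂
  obtain ⟨t, -, ht⟩ := oplus_assoc_right hs hr
  exact ⟨t, ht⟩

theorem ge_stabilize (a : S) : Ge a (stabilize a) := ⟨_, stabilize_core a⟩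

/-! ### Monotone closure and separating conjunction. -/

theorem isMonotone_monotonize (P : Set S) : IsMonotone (monotonize P) := by
  rintro x ⟨y, hy, hxy⟩ z hz
  exact ⟨y, hy, hz.trans hxy⟩

theorem subset_monotonize (P : Set S) : P ⊆ monotonize P := fun x hx => ⟨x, hx, ge_refl x⟩

theorem IsMonotone.monotonize_subset {P Q : Set S} (hQ : IsMonotone Q) (h : P ⊆ Q) :
    monotonize P ⊆ Q := by
  rintro x ⟨y, hy, hxy⟩
  exact hQ y (h hy) x hxy

theorem IsMonotone.monotonize_eq {P : Set S} (hP : IsMonotone P) : monotonize P = P :=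
  (hP.monotonize_subset subset_rfl).antisymm (subset_monotonize P)

theorem monotonize_union (P Q : Set S) : monotonize (P ∪ Q) = monotonize P ∪ monotonize Q := by
  ext x
  simp only [monotonize, Set.mem_ofPred_eq, Set.mem_union, or_and_right, exists_or]

theorem sepConj_mono {P P' Q Q' : Set S} (hP : P ⊆ P') (hQ : Q ⊆ Q') :
    sepConj P Q ⊆ sepConj P' Q' := by
  rintro x ⟨a, ha, b, hb, h⟩
  exact ⟨a, hP ha, b, hQ hb, h⟩

theorem sepConj_comm (P Q : Set S) : sepConj P Q = sepConj Q P := by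
  ext x
  constructor <;> rintro ⟨a, ha, b, hb, h⟩ <;> exact ⟨b, hb, a, ha, oplus_swap h⟩

/-- A surplus resource in the first conjunct can be moved outside of the whole sum. This carries the
closure through the inhale, exhale and conditional rules. -/
theorem sepConj_monotonize (P A : Set S) :
    sepConj (monotonize P) A = monotonize (sepConj P A) := by
  ext x
  constructor
  · rintro ⟨y, ⟨p, hp, r, hr⟩, a, ha, h⟩
    obtain ⟨q, h₁, h₂⟩ := oplus_right_comm hr h
    exact ⟨q, ⟨p, hp, a, ha, h₁⟩, r, h₂⟩
  · rintro ⟨q, ⟨p, hp, a, ha, h₁⟩, r, h₂⟩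
    obtain ⟨y, hr, h⟩ := oplus_right_comm h₁ h₂
    exact ⟨y, ⟨p, hp, r, hr⟩, a, ha, h⟩

theorem IsMonotone.sepConj_left {P : Set S} (hP : IsMonotone P) (A : Set S) :
    IsMonotone (sepConj P A) := by
  rw [← hP.monotonize_eq, sepConj_monotonize]
  exact isMonotone_monotonize _

theorem IsMonotone.sepConj_right {A : Set S} (hA : IsMonotone A) (P : Set S) :
    IsMonotone (sepConj P A) := by
  rw [sepConj_comm]
  exact hA.sepConj_left P

theorem IsMonotone.union {P Q : Set S} (hP : IsMonotone P) (hQ : IsMonotone Q) :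
    IsMonotone (P ∪ Q) := by
  rintro x (hx | hx) y hy
  exacts [.inl (hP x hx y hy), .inr (hQ x hx y hy)]

theorem IsMonotone.univ_sepConj {A : Set S} (hA : IsMonotone A) : sepConj Set.univ A = A := by
  ext x
  constructor
  · rintro ⟨a, -, b, hb, h⟩
    exact hA b hb x (ge_right h)
  · intro hx
    exact ⟨core x, trivial, x, hx, oplus_swap (oplus_core x)⟩

/-- The core of a state can be duplicated, so `x = x ⊕ core x` splits a state of the intersection.
This reconciles the IVL conditional, which uses separating conjunction, with the CSL one, which uses
intersection. -/
theorem IsMonotone.sepConj_eq_inter {P D : Set S} (hP : IsMonotone P) (hD : IsMonotone D)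
    (hcore : ∀ x ∈ D, core x ∈ D) : sepConj P D = P ∩ D := by
  ext x
  constructor
  · rintro ⟨a, ha, b, hb, h⟩
    exact ⟨hP a ha x (ge_left h), hD b hb x (ge_right h)⟩
  · rintro ⟨h₁, h₂⟩
    exact ⟨x, h₁, core x, hcore x h₂, oplus_core x⟩

theorem IsMonotoneExpr.evalsTo {e : S → Option Bool} (he : IsMonotoneExpr e) (b : Bool) :
    IsMonotone (evalsTo e b) := fun x hx y hy => he x y b hx hy

theorem IsPure.core_mem_evalsTo {e : S → Option Bool} (he : IsPure e) {b : Bool} {x : S}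
    (hx : x ∈ evalsTo e b) : core x ∈ evalsTo e b := (he x).symm.trans hx

/-! ### Framing and monotone closure. -/

theorem SelfFraming.monotonize {P : Set S} (hP : SelfFraming P) :
    SelfFraming (monotonize P) := by
  intro x
  constructor
  · rintro ⟨y, hy, r, hr⟩
    exact ⟨stabilize y, (hP y).1 hy, _, stabilize_sum _ _ _ hr⟩
  · rintro ⟨y, hy, h⟩
    exact ⟨y, hy, (ge_stabilize x).trans h⟩

/-- For a stable `x = y ⊕ r` with `y ∈ P`, stabilizing gives `x = stabilize y ⊕ stabilize r`. So
framing by the stable state `stabilize y ∈ P` transfers to `x` by adding `stabilize r`. Leftover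
cores are absorbed into `A` by monotonicity. -/
theorem Frames.monotonize {P A : Set S} (hP : SelfFraming P) (hA : IsMonotone A)
    (h : Frames P A) : Frames (monotonize P) A := by
  rintro x ⟨y, hy, r, hr⟩ hx z
  constructor
  · rintro ⟨x', rfl, a, ha, hz⟩
    have hx' := stabilize_sum _ _ _ hr
    rw [← stable_eq _ hx] at hx'
    obtain ⟨r', h₁, h₂⟩ := oplus_right_comm hr hz
    -- Write `y = stabilize y ⊕ core y` and move `core y` into the part that satisfies `A`.
    have hya := (h (stabilize y) ((hP y).1 hy) (stable_stabilize y) r').1 (by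
      obtain ⟨c, hc₁, hc₂⟩ := oplus_right_comm (stabilize_core y) h₁
      obtain ⟨c', hc₃, hc₄⟩ := oplus_assoc_right hc₁ hc₂
      exact ⟨_, rfl, c', hA a ha _ (ge_left hc₃), hc₄⟩)
    obtain ⟨y', rfl, a', ha', h₃⟩ := hya
    obtain ⟨c, hc₁, hc₂⟩ := oplus_right_comm h₃ (stabilize_sum _ _ _ h₂)
    rw [hx', Option.some_inj] at hc₁
    subst hc₁
    exact ⟨_, rfl, a', ha', hc₂⟩
  · rintro ⟨x', rfl, a, ha, hz⟩
    -- Here `z = stabilize z ⊕ core z`, and `core z` is absorbed into `a`.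
    obtain ⟨c, hc, hz'⟩ := oplus_assoc_right hz (stabilize_core z)
    exact ⟨_, rfl, c, hA a ha c (ge_left hc), hz'⟩

/-- Framing speaks of stable states only. A general `p ∈ P` is reduced to `stabilize p` by moving
`core p` into `A`. The converse direction is monotonicity, as `x ⪰ stabilize x`. -/
theorem SelfFraming.sepConj_of_frames {P A : Set S} (hP : SelfFraming P) (hA : IsMonotone A)
    (h : Frames P A) : SelfFraming (sepConj P A) := by
  intro x
  constructor
  · rintro ⟨p, hp, a, ha, hx⟩
    obtain ⟨c, hc₁, hc₂⟩ := oplus_right_comm (stabilize_core p) hx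
    obtain ⟨c', hc₃, hc₄⟩ := oplus_assoc_right hc₁ hc₂
    exact sepConj_mono (Set.singleton_subset_iff.2 ((hP p).1 hp)) subset_rfl
      ((h (stabilize p) ((hP p).1 hp) (stable_stabilize p) x).1
        ⟨_, rfl, c', hA a ha _ (ge_left hc₃), hc₄⟩)
  · intro hx
    exact hA.sepConj_right P _ hx x (ge_stabilize x)

/-- The set `D` of admitted outcomes treats "`e` is true" and "`e` is defined" at once; both are
needed for loops. -/
theorem StableUnder.selfFraming_inter {e : S → Option Bool}
    {P : Set S} (h : StableUnder e P) (hP : SelfFraming P) (D : Set (Option Bool)) :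
    SelfFraming {x | x ∈ P ∧ e x ∈ D} := by
  intro x
  constructor
  · rintro ⟨h₁, h₂⟩
    exact ⟨(hP x).1 h₁, h x h₁ ▸ h₂⟩
  · rintro ⟨h₁, h₂⟩
    have h₁' := (hP x).2 h₁
    exact ⟨h₁', (h x h₁').symm ▸ h₂⟩

end Algebra

/-! ## States -/

section States

variable {Var : Type w} {M : StateModel.{u}}

open IDFAlgebra

theorem State.oplus_iff {Δ : Ctx Var M} {a b c : State Δ} :
    IDFAlgebra.oplus a b = some c ↔
      a.store = c.store ∧ b.store = c.store ∧ IDFAlgebra.oplus a.heap b.heap = some c.heap :=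
  State.oplus_eq_some

theorem State.ge_iff {Δ : Ctx Var M} {a b : State Δ} :
    Ge a b ↔ b.store = a.store ∧ Ge a.heap b.heap := by
  constructor
  · rintro ⟨r, hr⟩
    obtain ⟨h₁, -, h₃⟩ := State.oplus_iff.1 hr
    exact ⟨h₁, r.heap, h₃⟩
  · rintro ⟨h₁, r, hr⟩
    exact ⟨a.withHeap r, State.oplus_iff.2 ⟨h₁, rfl, hr⟩⟩

/-- The states agree up to the value of `x`. -/
def AgreeOff {Δ : Ctx Var M} (x : Var) (a b : State Δ) : Prop :=
  (∀ y, y ≠ x → a.store y = b.store y) ∧ a.heap = b.heap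

theorem AgreeOff.symm {Δ : Ctx Var M} {x : Var} {a b : State Δ} (h : AgreeOff x a b) :
    AgreeOff x b a := ⟨fun y hy => (h.1 y hy).symm, h.2.symm⟩

variable [DecidableEq Var]

theorem State.typed_update {vars : Var → Option M.Ty} {store : Var → Option M.Val}
    (h : ∀ y, Option.Rel M.hasTy (store y) (vars y)) (x : Var) {v : M.Val} {t : M.Ty}
    (hv : M.hasTy v t) (y : Var) :
    Option.Rel M.hasTy (Function.update store x (some v) y) (Function.update vars x (some t) y) := by
  by_cases hy : y = x
  · subst hy
    simpa using Option.Rel.some hv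
  · simpa [hy] using h y

/-- `a[v/x]` as a state in `Δ[x ↦ t]`. -/
def State.upd {Δ : Ctx Var M} (a : State Δ) (x : Var) {v : M.Val} {t : M.Ty}
    (hv : M.hasTy v t) : State (Δ.set x t) :=
  ⟨Function.update a.store x (some v), a.heap, State.typed_update a.typed x hv⟩

theorem mem_existsVar {Δ : Ctx Var M} {x : Var} {t : M.Ty} {P : Set (State (Δ.set x t))}
    {a : State Δ} : a ∈ existsVar x t P ↔ ∃ (v : M.Val) (hv : M.hasTy v t), a.upd x hv ∈ P := by
  constructor
  · rintro ⟨v, hv, b, hb, h₁, h₂⟩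
    obtain rfl : b = a.upd x hv := State.ext h₁ h₂
    exact ⟨v, hv, hb⟩
  · rintro ⟨v, hv, h⟩
    exact ⟨v, hv, _, h, rfl, rfl⟩

theorem IsUpd.agreeOff {Δ : Ctx Var M} {x : Var} {v : M.Val} {a b : State Δ}
    (h : IsUpd a x v b) : AgreeOff x a b := by
  refine ⟨fun y hy => ?_, h.2.symm⟩
  rw [h.1, Function.update_of_ne hy]

/-- Both states are typed in the same context, so `x` is defined in both or in neither. This makes
the symmetric relation `AgreeOff` usable in place of overwriting, also for undeclared variables. -/
theorem AgreeOff.eq_or_isUpd {Δ : Ctx Var M} {x : Var} {a b : State Δ} (h : AgreeOff x a b) :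
    a = b ∨ ∃ v, IsUpd a x v b := by
  have ha := a.typed x
  have hb := b.typed x
  rcases hbx : b.store x with _ | v
  · left
    refine State.ext (funext fun y => ?_) h.2
    by_cases hy : y = x
    · subst hy
      rw [hbx] at hb ⊢
      generalize hΔ : Δ.vars y = o at ha hb
      cases hb
      generalize a.store y = o at ha
      cases ha
      rfl
    · exact h.1 y hy
  · right
    refine ⟨v, funext fun y => ?_, h.2.symm⟩
    by_cases hy : y = x
    · subst hy
      rw [hbx, Function.update_self]
    · rw [Function.update_of_ne hy, h.1 y hy]

theorem independent_iff {Δ : Ctx Var M} {P : Set (State Δ)} {x : Var} :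
    Independent P x ↔ ∀ a b, AgreeOff x a b → a ∈ P → b ∈ P := by
  constructor
  · intro h a b hab ha
    rcases hab.eq_or_isUpd with rfl | ⟨v, hv⟩
    exacts [ha, (h a b v hv).1 ha]
  · intro h a b v hv
    exact ⟨h a b hv.agreeOff, h b a hv.agreeOff.symm⟩

theorem AgreeOff.upd {Δ : Ctx Var M} {x : Var} {a b : State Δ} (h : AgreeOff x a b) (y : Var)
    {v : M.Val} {t : M.Ty} (hv : M.hasTy v t) : AgreeOff x (a.upd y hv) (b.upd y hv) := by
  refine ⟨fun z hz => ?_, h.2⟩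
  simp only [State.upd, Function.update_apply, h.1 z hz]

theorem AgreeOff.upd_eq {Δ : Ctx Var M} {x : Var} {a b : State Δ} (h : AgreeOff x a b)
    {v : M.Val} {t : M.Ty} (hv : M.hasTy v t) : a.upd x hv = b.upd x hv := by
  refine State.ext (funext fun z => ?_) h.2
  by_cases hz : z = x
  · subst hz
    simp [State.upd]
  · simp [State.upd, hz, h.1 z hz]

theorem independent_existsVar_self {Δ : Ctx Var M} (x : Var) {t : M.Ty}
    (P : Set (State (Δ.set x t))) : Independent (existsVar x t P) x := by
  refine independent_iff.2 fun a b hab ha => ?_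
  obtain ⟨v, hv, h⟩ := mem_existsVar.1 ha
  exact mem_existsVar.2 ⟨v, hv, hab.upd_eq hv ▸ h⟩

theorem Independent.existsVar {Δ : Ctx Var M} {x y : Var} {t : M.Ty}
    {P : Set (State (Δ.set y t))} (hP : Independent P x) :
    Independent (existsVar y t P) x := by
  refine independent_iff.2 fun a b hab ha => ?_
  obtain ⟨v, hv, h⟩ := mem_existsVar.1 ha
  exact mem_existsVar.2 ⟨v, hv, independent_iff.1 hP _ _ (hab.upd y hv) h⟩

theorem Independent.sepConj {Δ : Ctx Var M} {x : Var} {P Q : Set (State Δ)}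
    (hP : Independent P x) (hQ : Independent Q x) : Independent (sepConj P Q) x := by
  rw [independent_iff] at *
  rintro a b hab ⟨c, hc, d, hd, h⟩
  obtain ⟨h₁, h₂, h₃⟩ := State.oplus_iff.1 h
  refine ⟨b.withHeap c.heap, hP c _ ⟨fun y hy => ?_, rfl⟩ hc, b.withHeap d.heap,
    hQ d _ ⟨fun y hy => ?_, rfl⟩ hd, State.oplus_iff.2 ⟨rfl, rfl, hab.2 ▸ h₃⟩⟩
  · rw [h₁]; exact hab.1 y hy
  · rw [h₂]; exact hab.1 y hy

theorem Independent.union {Δ : Ctx Var M} {x : Var} {P Q : Set (State Δ)}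
    (hP : Independent P x) (hQ : Independent Q x) : Independent (P ∪ Q) x :=
  fun a b v h => or_congr (hP a b v h) (hQ a b v h)

/-- `∃ x ∈ Δ(x). P`. -/
def havocPost {Δ : Ctx Var M} (x : Var) (t : M.Ty) (P : Set (State Δ)) : Set (State Δ) :=
  {a | ∃ v, M.hasTy v t ∧ ∃ b ∈ P, IsUpd a x v b}

/-- Havoc changes the store only and the closure changes the heap only, so they commute. -/
theorem monotonize_havocPost {Δ : Ctx Var M} (x : Var) (t : M.Ty) (P : Set (State Δ)) :
    monotonize (havocPost x t P) = havocPost x t (monotonize P) := by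
  ext a
  constructor
  · rintro ⟨c, ⟨v, hv, b, hb, h₁, h₂⟩, hac⟩
    obtain ⟨h₃, h₄⟩ := State.ge_iff.1 hac
    exact ⟨v, hv, b.withHeap a.heap, ⟨b, hb, State.ge_iff.2 ⟨rfl, by rw [h₂]; exact h₄⟩⟩,
      by rw [← h₃]; exact h₁, rfl⟩
  · rintro ⟨v, hv, b, ⟨c, hc, hbc⟩, h₁, h₂⟩
    obtain ⟨h₃, h₄⟩ := State.ge_iff.1 hbc
    rw [h₂] at h₄
    exact ⟨a.withHeap c.heap, ⟨v, hv, c, hc, h₃.trans h₁, rfl⟩, State.ge_iff.2 ⟨rfl, h₄⟩⟩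

/-- A declared variable has a value of its type, which serves as the witness. -/
theorem subset_havocPost {Δ : Ctx Var M} {x : Var} {t : M.Ty} (ht : Δ.vars x = some t)
    (P : Set (State Δ)) : P ⊆ havocPost x t P := by
  intro a ha
  have h := a.typed x
  rw [ht] at h
  rcases hx : a.store x with _ | v
  · rw [hx] at h; cases h
  · rw [hx] at h
    cases h with
    | some h => exact ⟨v, h, a, ha, by rw [← hx, Function.update_eq_self], rfl⟩

theorem independent_havocPost_self {Δ : Ctx Var M} (x : Var) (t : M.Ty) (P : Set (State Δ)) :
    Independent (havocPost x t P) x := by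
  refine independent_iff.2 fun a b hab ⟨v, hv, c, hc, h₁, h₂⟩ => ?_
  refine ⟨v, hv, c, hc, h₁.trans (funext fun z => ?_), h₂.trans hab.2⟩
  by_cases hz : z = x
  · subst hz
    simp
  · simp [hz, hab.1 z hz]

theorem Independent.havocPost {Δ : Ctx Var M} {x y : Var} {t : M.Ty} {P : Set (State Δ)}
    (ht : Δ.vars y = some t) (hP : Independent P x) : Independent (havocPost y t P) x := by
  refine independent_iff.2 fun a b hab ⟨v, hv, c, hc, h₁, h₂⟩ => ?_
  -- Since `y` already has type `t` in `Δ`, overwriting it stays within the same context.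
  have hty : ∀ z, Option.Rel M.hasTy (Function.update b.store y (some v) z) (Δ.vars z) := by
    have := State.typed_update b.typed y hv
    rwa [← ht, Function.update_eq_self] at this
  refine ⟨v, hv, ⟨_, b.heap, hty⟩, independent_iff.1 hP c _ ⟨fun z hz => ?_, ?_⟩ hc, rfl, rfl⟩
  · simp only [h₁, Function.update_apply, hab.1 z hz]
  · exact h₂.trans hab.2

end States

/-! ## The axiomatic semantics of the IVL -/

namespace IVL

variable {Var : Type w} {V : IVL.{v, w} Var} {Δ : Ctx Var V.M}

theorem Stmt.inhalesMonotone_havocs (xs : List Var) :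
    (Stmt.havocs (V := V) xs).InhalesMonotone Δ := by
  induction xs with
  | nil => trivial
  | cons x xs ih => exact ⟨trivial, ih⟩

theorem BExp.evalsTo_not (b : V.BExp) :
    evalsTo (b.not.eval (Δ := Δ)) true = evalsTo b.eval false := by
  ext a
  simp only [evalsTo, BExp.not, Set.mem_ofPred_eq]
  rcases b.eval a with _ | _ | _ <;> simp

variable [DecidableEq Var]

/-- Each rule commutes with the closure. Only `inhale` needs the hypothesis on `C`: a closed
precondition still frames the inhaled assertion because that assertion is monotone. -/
theorem Ax.monotonize {P Q : Set (State Δ)} {C : V.Stmt} (h : V.Ax Δ P C Q)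
    (hC : C.InhalesMonotone Δ) : V.Ax Δ (monotonize P) C (monotonize Q) := by
  induction h with
  | skip P hP => exact .skip _ hP.monotonize
  | prim P Q c hP hQ h =>
    exact .prim _ _ _ hP.monotonize hQ.monotonize (V.primRule_affine _ _ _ _ hP hQ h)
  | inhale P A hP h =>
    rw [← sepConj_monotonize]
    exact .inhale _ _ hP.monotonize (h.monotonize hP hC)
  | exhale P Q A hP h hQ =>
    refine .exhale _ _ _ hP.monotonize ?_ hQ.monotonize
    rw [sepConj_monotonize]
    exact (isMonotone_monotonize _).monotonize_subset (h.trans (subset_monotonize _))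
  | havoc P x t hP ht =>
    have := Ax.havoc (V := V) _ x t hP.monotonize ht
    change V.Ax Δ _ _ (havocPost x t _) at this
    rwa [← monotonize_havocPost] at this
  | seq P R Q c₁ c₂ _ _ ih₁ ih₂ => exact .seq _ _ _ _ _ (ih₁ hC.1) (ih₂ hC.2)
  | ite P B₁ B₂ b c₁ c₂ hP hb _ _ ih₁ ih₂ =>
    rw [monotonize_union]
    refine .ite _ _ _ _ _ _ hP.monotonize ?_ ?_ ?_
    · rintro x ⟨y, hy, hxy⟩
      obtain ⟨c, hc⟩ := Option.isSome_iff_exists.1 (hb y hy)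
      rw [b.mono Δ y x c hc hxy]
      rfl
    · rw [sepConj_monotonize]; exact ih₁ hC.1
    · rw [sepConj_monotonize]; exact ih₂ hC.2

/-! ### Inversion of the rules. -/

theorem Ax.skip_inv {P Q : Set (State Δ)} (h : V.Ax Δ P .skip Q) : SelfFraming P ∧ Q = P := by
  cases h with
  | skip _ h => exact ⟨h, rfl⟩

theorem Ax.inhale_inv {P Q : Set (State Δ)} {A : V.Assn} (h : V.Ax Δ P (.inhale A) Q) :
    SelfFraming P ∧ Frames P (A Δ) ∧ Q = sepConj P (A Δ) := by
  cases h with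
  | inhale _ _ h₁ h₂ => exact ⟨h₁, h₂, rfl⟩

theorem Ax.exhale_inv {P Q : Set (State Δ)} {A : V.Assn} (h : V.Ax Δ P (.exhale A) Q) :
    SelfFraming P ∧ P ⊆ sepConj Q (A Δ) ∧ SelfFraming Q := by
  cases h with
  | exhale _ _ _ h₁ h₂ h₃ => exact ⟨h₁, h₂, h₃⟩

theorem Ax.havoc_inv {P Q : Set (State Δ)} {x : Var} (h : V.Ax Δ P (.havoc x) Q) :
    ∃ t, Δ.vars x = some t ∧ SelfFraming P ∧ Q = havocPost x t P := by
  cases h with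
  | havoc _ _ t h₁ h₂ => exact ⟨t, h₂, h₁, rfl⟩

theorem Ax.seq_inv {P Q : Set (State Δ)} {c₁ c₂ : V.Stmt} (h : V.Ax Δ P (.seq c₁ c₂) Q) :
    ∃ R, V.Ax Δ P c₁ R ∧ V.Ax Δ R c₂ Q := by
  cases h with
  | seq _ R _ _ _ h₁ h₂ => exact ⟨R, h₁, h₂⟩

theorem Ax.ite_inv {P Q : Set (State Δ)} {b : V.BExp} {c₁ c₂ : V.Stmt}
    (h : V.Ax Δ P (.ite b c₁ c₂) Q) :
    ∃ B₁ B₂, Q = B₁ ∪ B₂ ∧ FramesExpr P b.eval ∧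
      V.Ax Δ (sepConj P (evalsTo b.eval true)) c₁ B₁ ∧
      V.Ax Δ (sepConj P (evalsTo b.not.eval true)) c₂ B₂ := by
  cases h with
  | ite _ B₁ B₂ _ _ _ _ h₁ h₂ h₃ => exact ⟨B₁, B₂, rfl, h₁, h₂, h₃⟩

/-- The third conjunct strengthens the induction: independence gained by one havoc must survive the
later ones. -/
theorem Ax.havocs {xs : List Var} {P Q : Set (State Δ)} (h : V.Ax Δ P (.havocs xs) Q) :
    P ⊆ Q ∧ (∀ x ∈ xs, Independent Q x) ∧ ∀ x, Independent P x → Independent Q x := by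
  induction xs generalizing P with
  | nil =>
    obtain ⟨-, rfl⟩ := Ax.skip_inv h
    exact ⟨subset_rfl, by simp, fun _ h => h⟩
  | cons x xs ih =>
    obtain ⟨R, h₁, h₂⟩ := Ax.seq_inv h
    obtain ⟨t, ht, -, rfl⟩ := h₁.havoc_inv
    obtain ⟨i₁, i₂, i₃⟩ := ih h₂
    refine ⟨(subset_havocPost ht P).trans i₁, ?_, fun y hy => i₃ y (hy.havocPost ht)⟩
    intro y hy
    rcases List.mem_cons.1 hy with rfl | hy
    exacts [i₃ _ (independent_havocPost_self _ t P), i₂ y hy]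

end IVL

/-! ## The state encoding -/

namespace Translation

open IDFAlgebra

variable {Var : Type w} {F : FrontEnd.{u, w} Var} {V : IVL.{v, w} Var} {T : Translation F V}
  {Δ : Ctx Var F.M}

theorem btr_mono {P Q : Set (State (T.trCtx Δ))} (h : P ⊆ Q) : T.btr P ⊆ T.btr Q := by
  rintro ω ⟨Ω, hΩ, hr⟩
  exact ⟨Ω, h hΩ, hr⟩

theorem btr_union (P Q : Set (State (T.trCtx Δ))) : T.btr (P ∪ Q) = T.btr P ∪ T.btr Q := by
  ext ω
  simp only [btr, Set.mem_ofPred_eq, Set.mem_union, or_and_right, exists_or]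

theorem sepConj_evalsTo {P : Set (State (T.trCtx Δ))} (hP : IsMonotone P) (b : V.BExp) (d : Bool) :
    sepConj P (evalsTo b.eval d) = P ∩ evalsTo b.eval d :=
  hP.sepConj_eq_inter ((b.mono _).evalsTo d) fun _ => (b.pure _).core_mem_evalsTo

/-- Translating a context and extending it by a variable commute only up to a propositional equality
of the variable parts. Keeping store and heap explicit avoids casts between the two state types. -/
theorem mem_assn_congr (B : V.Assn) {vars vars' : Var → Option V.M.Ty} (h : vars = vars')
    {γ : V.M.HCtx} (store : Var → Option V.M.Val) (Φ : V.M.Heap γ)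
    (h₁ : ∀ x, Option.Rel V.M.hasTy (store x) (vars x))
    (h₂ : ∀ x, Option.Rel V.M.hasTy (store x) (vars' x)) :
    (⟨store, Φ, h₁⟩ : State ⟨vars, γ⟩) ∈ B ⟨vars, γ⟩ ↔
      (⟨store, Φ, h₂⟩ : State ⟨vars', γ⟩) ∈ B ⟨vars', γ⟩ := by
  subst h
  rfl

/-- The IVL assertion `A'` encodes the front-end assertion `A`. -/
structure Encodes (T : Translation F V) (A : ∀ Δ : Ctx Var F.M, Set (State Δ)) (A' : V.Assn) :
    Prop where
  sem : ∀ (Δ : Ctx Var F.M) (ω : State Δ) (Ω : State (T.trCtx Δ)), T.relS ω Ω →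
    (ω ∈ A Δ ↔ Ω ∈ A' (T.trCtx Δ))
  mono : ∀ Δ : Ctx Var F.M, IsMonotone (A' (T.trCtx Δ))
  gbs : T.GenBackwardSat A A'

theorem Encodes.or {A B : ∀ Δ : Ctx Var F.M, Set (State Δ)} {A' B' : V.Assn}
    (hA : T.Encodes A A') (hB : T.Encodes B B') :
    T.Encodes (fun Δ => A Δ ∪ B Δ) (A'.or B') where
  sem Δ ω Ω hr := or_congr (hA.sem Δ ω Ω hr) (hB.sem Δ ω Ω hr)
  mono Δ := (hA.mono Δ).union (hB.mono Δ)
  gbs Δ ω Ω ΩA ΩF hr h := by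
    rintro (h' | h')
    · obtain ⟨ωA, ωF, ΩF', h₁, h₂, h₃⟩ := hA.gbs Δ ω Ω ΩA ΩF hr h h'
      exact ⟨ωA, ωF, ΩF', h₁, .inl h₂, h₃⟩
    · obtain ⟨ωA, ωF, ΩF', h₁, h₂, h₃⟩ := hB.gbs Δ ω Ω ΩA ΩF hr h h'
      exact ⟨ωA, ωF, ΩF', h₁, .inr h₂, h₃⟩

variable [DecidableEq Var]

/-- The translation of a store is well-typed. -/
theorem Requirements.typed (hT : T.Requirements) {store : Var → Option F.M.Val}
    {vars : Var → Option F.M.Ty} (h : ∀ x, Option.Rel F.M.hasTy (store x) (vars x)) (x : Var) :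
    Option.Rel V.M.hasTy ((store x).map T.trVal) ((vars x).map T.trTy) := by
  have hx := h x
  generalize store x = s at hx
  generalize vars x = t at hx
  cases hx with
  | none => exact .none
  | some h => exact .some (hT.trVal_typed _ _ ((F.hasTy_iff _ _).1 h))

/-- The encoding of a state with a given encoding of its heap. -/
def Requirements.encode (hT : T.Requirements) (ω : State Δ) (Φ : V.M.Heap (T.trHCtx Δ.heap)) :
    State (T.trCtx Δ) :=
  ⟨fun x => (ω.store x).map T.trVal, Φ, hT.typed ω.typed⟩

theorem Requirements.relS_encode (hT : T.Requirements) {ω : State Δ}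
    {Φ : V.M.Heap (T.trHCtx Δ.heap)} (h : T.relH ω.heap Φ) : T.relS ω (hT.encode ω Φ) :=
  ⟨rfl, h⟩

theorem Requirements.relS_total (hT : T.Requirements) (ω : State Δ) : ∃ Ω, T.relS ω Ω := by
  obtain ⟨Φ, h⟩ := hT.relH_total _ ω.heap
  exact ⟨_, hT.relS_encode h⟩

theorem Requirements.relS_split (hT : T.Requirements) {ω ω₁ ω₂ : State Δ}
    {Ω : State (T.trCtx Δ)} (h : oplus ω₁ ω₂ = some ω) (hr : T.relS ω Ω) :
    ∃ Ω₁ Ω₂, oplus Ω₁ Ω₂ = some Ω ∧ T.relS ω₁ Ω₁ ∧ T.relS ω₂ Ω₂ := by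
  obtain ⟨h₁, h₂, h₃⟩ := State.oplus_iff.1 h
  obtain ⟨Φ₁, Φ₂, h₄, h₅, h₆⟩ := hT.relH_split _ _ _ _ _ h₃ hr.2
  exact ⟨Ω.withHeap Φ₁, Ω.withHeap Φ₂, State.oplus_iff.2 ⟨rfl, rfl, h₄⟩,
    ⟨by rw [h₁]; exact hr.1, h₅⟩, ⟨by rw [h₂]; exact hr.1, h₆⟩⟩

theorem Requirements.relS_extend (hT : T.Requirements) {ω ω₁ ω₀ : State Δ}
    {Ω : State (T.trCtx Δ)} (hr : T.relS ω Ω) (h : oplus ω ω₁ = some ω₀) :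
    ∃ Ω₁ Ω₀, T.relS ω₁ Ω₁ ∧ oplus Ω Ω₁ = some Ω₀ ∧ T.relS ω₀ Ω₀ := by
  obtain ⟨h₁, h₂, h₃⟩ := State.oplus_iff.1 h
  obtain ⟨Φ₁, Φ₀, h₄, h₅, h₆⟩ := hT.relH_extend _ _ _ _ _ hr.2 h₃
  exact ⟨Ω.withHeap Φ₁, Ω.withHeap Φ₀, ⟨by rw [h₂, ← h₁]; exact hr.1, h₄⟩,
    State.oplus_iff.2 ⟨rfl, rfl, h₅⟩, ⟨by rw [← h₁]; exact hr.1, h₆⟩⟩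

theorem Requirements.relS_stabilize (hT : T.Requirements) {ω : State Δ} {Ω : State (T.trCtx Δ)}
    (h : T.relS ω Ω) : T.relS (stabilize ω) (stabilize Ω) :=
  ⟨h.1, hT.relH_stabilize _ _ _ h.2⟩

theorem Requirements.relS_unstabilize (hT : T.Requirements) {ω : State Δ}
    {Ω' : State (T.trCtx Δ)} (h : T.relS (stabilize ω) Ω') :
    ∃ Ω, stabilize Ω = stabilize Ω' ∧ T.relS ω Ω := by
  obtain ⟨Φ, h₁, h₂⟩ := hT.relH_unstabilize _ _ _ h.2
  exact ⟨Ω'.withHeap Φ, State.ext rfl h₁, h.1, h₂⟩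

/-! ## Backward translation of semantic assertions -/

/-- For the converse, an encoding of `stabilize ω` is exchanged for an encoding of `ω` with the same
stabilization; membership in a self-framing set depends on the stabilization only. -/
theorem Requirements.selfFraming_btr (hT : T.Requirements) {P : Set (State (T.trCtx Δ))}
    (hP : SelfFraming P) : SelfFraming (T.btr P) := by
  intro ω
  constructor
  · rintro ⟨Ω, hΩ, hr⟩
    exact ⟨stabilize Ω, (hP Ω).1 hΩ, hT.relS_stabilize hr⟩
  · rintro ⟨Ω', hΩ', hr⟩
    obtain ⟨Ω, h₁, h₂⟩ := hT.relS_unstabilize hr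
    exact ⟨Ω, (hP Ω).2 (h₁ ▸ (hP Ω').1 hΩ'), h₂⟩

/-- Backward translation commutes with conjunction with a translated Boolean expression. -/
theorem Requirements.btr_inter_evalsTo (hT : T.Requirements) (P : Set (State (T.trCtx Δ)))
    (b : F.BE) (d : Bool) :
    T.btr (P ∩ evalsTo (T.trBE b).eval d) = T.btr P ∩ evalsTo (F.evalBE b) d := by
  ext ω
  constructor
  · rintro ⟨Ω, ⟨h₁, h₂⟩, hr⟩
    exact ⟨⟨Ω, h₁, hr⟩, (hT.trBE_sem b Δ ω Ω hr).trans h₂⟩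
  · rintro ⟨⟨Ω, h₁, hr⟩, h₂⟩
    exact ⟨Ω, ⟨h₁, (hT.trBE_sem b Δ ω Ω hr).symm.trans h₂⟩, hr⟩

theorem Requirements.framesExpr_btr (hT : T.Requirements) {P : Set (State (T.trCtx Δ))}
    {b : F.BE} (h : FramesExpr P (T.trBE b).eval) : FramesExpr (T.btr P) (F.evalBE b) := by
  rintro ω ⟨Ω, hΩ, hr⟩
  rw [hT.trBE_sem b Δ ω Ω hr]
  exact h Ω hΩ

/-- Monotonicity is inherited from the IVL: an encoding of a state extends to an encoding of any
larger state, and values agree along encodings. -/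
theorem Requirements.isMonotoneExpr (hT : T.Requirements) (b : F.BE) :
    IsMonotoneExpr (F.evalBE b (Δ := Δ)) := by
  rintro ω ω' d h ⟨ω₁, h₁⟩
  obtain ⟨Ω, hr⟩ := hT.relS_total ω
  obtain ⟨Ω₁, Ω', -, h₂, h₃⟩ := hT.relS_extend hr h₁
  rw [hT.trBE_sem b Δ _ _ h₃]
  refine (T.trBE b).mono _ Ω Ω' d ?_ ⟨_, h₂⟩
  rw [← hT.trBE_sem b Δ _ _ hr, h]

theorem Requirements.independent_btr (hT : T.Requirements)
    {P : Set (State (T.trCtx Δ))} {x : Var} (hP : Independent P x) :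
    Independent (T.btr P) x := by
  refine independent_iff.2 ?_
  rintro a b hab ⟨A, hA, hr⟩
  -- The store of an encoding is determined by the front-end store, so re-encoding `b` over the same
  -- heap alters at most `x`.
  refine ⟨hT.encode b A.heap, independent_iff.1 hP A _ ⟨fun y hy => ?_, rfl⟩ hA,
    hT.relS_encode (hab.2 ▸ hr.2)⟩
  rw [hr.1]
  exact congrArg (Option.map T.trVal) (hab.1 y hy)

/-! ## Correspondence of assertions -/

namespace Encodes

variable {A B : ∀ Δ : Ctx Var F.M, Set (State Δ)} {A' B' : V.Assn}

theorem btr_eq (h : T.Encodes A A') (hT : T.Requirements) :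
    T.btr (A' (T.trCtx Δ)) = A Δ := by
  ext ω
  constructor
  · rintro ⟨Ω, hΩ, hr⟩
    exact (h.sem _ _ _ hr).2 hΩ
  · intro hω
    obtain ⟨Ω, hr⟩ := hT.relS_total ω
    exact ⟨Ω, (h.sem _ _ _ hr).1 hω, hr⟩

theorem wellFormed (h : T.Encodes A A') (hT : T.Requirements) :
    T.WellFormed (A' (T.trCtx Δ)) := by
  rw [WellFormed, h.btr_eq hT]
  ext ω
  refine ⟨fun hω Ω hr => (h.sem _ _ _ hr).1 hω, fun H => ?_⟩
  obtain ⟨Ω, hr⟩ := hT.relS_total ω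
  exact (h.sem _ _ _ hr).2 (H Ω hr)

theorem isMonotone_front (h : T.Encodes A A') (hT : T.Requirements) : IsMonotone (A Δ) := by
  rintro ω hω ω' ⟨ω₁, h₁⟩
  obtain ⟨Ω, hr⟩ := hT.relS_total ω
  obtain ⟨Ω₁, Ω', -, h₂, h₃⟩ := hT.relS_extend hr h₁
  exact (h.sem _ _ _ h₃).2 (h.mono Δ Ω ((h.sem _ _ _ hr).1 hω) Ω' ⟨_, h₂⟩)

theorem inp (hT : T.Requirements) (a : F.Inp) : T.Encodes (F.satInp a) (T.trInp a) :=
  ⟨hT.trInp_sem a, hT.trInp_mono a, hT.trInp_gbs a⟩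

theorem evalsTo (hT : T.Requirements) (b : F.BE) (d : Bool) :
    T.Encodes (fun _ => evalsTo (F.evalBE b) d) (fun _ => evalsTo (T.trBE b).eval d) where
  sem Δ ω Ω hr := by
    simp only [SLTrans.evalsTo, Set.mem_ofPred_eq, hT.trBE_sem b Δ ω Ω hr]
  mono Δ := ((T.trBE b).mono _).evalsTo d
  gbs Δ ω Ω ΩA ΩF hr h hA := by
    -- By purity the core suffices to satisfy the expression, so the whole of `ω` can be kept as the
    -- frame.
    refine ⟨core ω, ω, Ω, oplus_swap (oplus_core ω), (hT.be_pure b Δ).core_mem_evalsTo ?_, hr,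
      ge_right h⟩
    exact (hT.trBE_sem b Δ ω Ω hr).trans ((T.trBE b).mono _ _ _ _ hA (ge_left h))

/-- From front-end to IVL, splits are encoded directly. In the other direction, backward
satisfiability peels off one conjunct and monotonicity absorbs the growth of the remaining encoding.
-/
theorem sep (hA : T.Encodes A A') (hB : T.Encodes B B') (hT : T.Requirements) :
    T.Encodes (fun Δ => sepConj (A Δ) (B Δ)) (A'.sep B') where
  sem Δ ω Ω hr := by
    constructor
    · rintro ⟨ω₁, h₁, ω₂, h₂, h⟩
      obtain ⟨Ω₁, Ω₂, h', r₁, r₂⟩ := hT.relS_split h hr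
      exact ⟨Ω₁, (hA.sem _ _ _ r₁).1 h₁, Ω₂, (hB.sem _ _ _ r₂).1 h₂, h'⟩
    · rintro ⟨Ω₁, h₁, Ω₂, h₂, h⟩
      obtain ⟨ω₁, ω₂, Ω₂', h', m₁, r₂, hge⟩ := hA.gbs Δ ω Ω Ω₁ Ω₂ hr h h₁
      exact ⟨ω₁, m₁, ω₂, (hB.sem _ _ _ r₂).2 (hB.mono _ _ h₂ _ hge), h'⟩
  mono Δ := (hA.mono Δ).sepConj_left _
  gbs Δ ω Ω ΩA ΩF hr h := by
    rintro ⟨Ω₁, h₁, Ω₂, h₂, h₁₂⟩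
    -- Peel off `Ω₁` with frame `Ω₂ ⊕ ΩF`, then `Ω₂` from the remainder. The surplus `R` of the
    -- first step is added to the frame of the second.
    obtain ⟨Ω₂F, e₁, e₂⟩ := oplus_assoc_right h₁₂ h
    obtain ⟨ω₁, ω', Ω', f₁, m₁, r', R, hR⟩ := hA.gbs Δ ω Ω Ω₁ Ω₂F hr e₂ h₁
    obtain ⟨ΩFR, e₃, e₄⟩ := oplus_assoc_right e₁ hR
    obtain ⟨ω₂, ωF, ΩF', f₂, m₂, r₂, hge⟩ := hB.gbs Δ ω' Ω' Ω₂ ΩFR r' e₄ h₂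
    obtain ⟨ωA, g₁, g₂⟩ := oplus_assoc_left f₂ f₁
    exact ⟨ωA, ωF, ΩF', g₂, ⟨ω₁, m₁, ω₂, m₂, g₁⟩, r₂, hge.trans (ge_left e₃)⟩

theorem imp (hA : T.Encodes A A') (hT : T.Requirements) (b : F.BE) :
    T.Encodes (fun Δ => {a | (F.evalBE b a).isSome ∧ (F.evalBE b a = some true → a ∈ A Δ)})
      (.imp (T.trBE b) A') where
  sem Δ ω Ω hr := by
    simp only [IVL.Assn.imp, Set.mem_ofPred_eq, hT.trBE_sem b Δ ω Ω hr, hA.sem Δ ω Ω hr]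
  mono Δ := by
    rintro Ω ⟨h₁, h₂⟩ Ω' hge
    obtain ⟨d, hd⟩ := Option.isSome_iff_exists.1 h₁
    have hd' := (T.trBE b).mono _ _ _ _ hd hge
    refine ⟨by rw [hd']; rfl, fun ht => hA.mono Δ _ (h₂ ?_) _ hge⟩
    rw [hd, ← hd', ht]
  gbs Δ ω Ω ΩA ΩF hr h := by
    rintro ⟨h₁, h₂⟩
    obtain ⟨d, hd⟩ := Option.isSome_iff_exists.1 h₁
    have hω : F.evalBE b ω = some d :=
      (hT.trBE_sem b Δ ω Ω hr).trans ((T.trBE b).mono _ _ _ _ hd (ge_left h))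
    have hcore : F.evalBE b (core ω) = some d := (hT.be_pure b Δ).core_mem_evalsTo hω
    cases d with
    | false =>
      refine ⟨core ω, ω, Ω, oplus_swap (oplus_core ω), ⟨?_, ?_⟩, hr, ge_right h⟩ <;> simp [hcore]
    | true =>
      obtain ⟨ωA, ωF, ΩF', e, m, r, hge⟩ := hA.gbs Δ ω Ω ΩA ΩF hr h (h₂ hd)
      -- The state `ωA` need not define `b`. Adding `core ω`, which `ω` absorbs, makes `b` defined
      -- without changing the total.
      obtain ⟨ωA', e₁, e₂⟩ := oplus_right_comm e (oplus_core ω)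
      refine ⟨ωA', ωF, ΩF', e₂, ⟨?_, fun _ => ?_⟩, r, hge⟩
      · rw [hT.isMonotoneExpr b _ _ _ hcore (ge_right e₁)]
        rfl
      · exact hA.isMonotone_front hT _ m _ (ge_left e₁)

end Encodes

/-! ### The existential quantifier. -/

theorem trCtx_set_vars (x : Var) (t : F.M.Ty) :
    (T.trCtx (Δ.set x t)).vars = ((T.trCtx Δ).set x (T.trTy t)).vars := by
  funext y
  by_cases hy : y = x
  · subst hy
    simp [trCtx, Ctx.set]
  · simp [trCtx, Ctx.set, hy]

/-- `Ω[v/x]` as a state in the translation of `Δ[x ↦ t]`. -/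
def updTr (Ω : State (T.trCtx Δ)) (x : Var) {v : V.M.Val} {t : F.M.Ty}
    (hv : V.M.hasTy v (T.trTy t)) : State (T.trCtx (Δ.set x t)) :=
  ⟨Function.update Ω.store x (some v), Ω.heap, fun y => by
    rw [trCtx_set_vars]
    exact State.typed_update Ω.typed x hv y⟩

theorem mem_ex_trCtx {x : Var} {t : F.M.Ty} {B : V.Assn} {Ω : State (T.trCtx Δ)} :
    Ω ∈ IVL.Assn.ex x (T.trTy t) B (T.trCtx Δ) ↔
      ∃ (v : V.M.Val) (hv : V.M.hasTy v (T.trTy t)),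
        updTr Ω x hv ∈ B (T.trCtx (Δ.set x t)) := by
  refine mem_existsVar.trans (exists₂_congr fun v hv => ?_)
  exact mem_assn_congr B (trCtx_set_vars x t).symm _ _ _ _

/-- `relS` is preserved by overwriting with corresponding values. -/
theorem relS_upd {ω : State Δ} {Ω : State (T.trCtx Δ)} (h : T.relS ω Ω) (x : Var)
    {v : F.M.Val} {t : F.M.Ty} (hv : F.M.hasTy v t) (hv' : V.M.hasTy (T.trVal v) (T.trTy t)) :
    T.relS (ω.upd x hv) (updTr Ω x hv') := by
  refine ⟨funext fun y => ?_, h.2⟩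
  by_cases hy : y = x
  · subst hy
    simp [State.upd, updTr]
  · simp [State.upd, updTr, hy, h.1]

/-- `B'` is `A'` with the condition that the value of `x` comes from a front-end value of
type `t`. -/
theorem Encodes.ex_aux {A : ∀ Δ : Ctx Var F.M, Set (State Δ)} {A' B' : V.Assn}
    (hA : T.Encodes A A') (hT : T.Requirements) {x : Var} {t : F.M.Ty}
    (hB : ∀ (Δ : Ctx Var F.M) (Ω : State (T.trCtx Δ)) v, Ω.store x = some v →
      V.M.hasTy v (T.trTy t) →
      (Ω ∈ B' (T.trCtx Δ) ↔ Ω ∈ A' (T.trCtx Δ) ∧ ∃ v₀, F.tp v₀ = t ∧ T.trVal v₀ = v)) :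
    T.Encodes (fun Δ => existsVar x t (A (Δ.set x t))) (.ex x (T.trTy t) B') := by
  -- The condition in `B'` excludes IVL values without a front-end counterpart, so the quantifier
  -- ranges over translated values only.
  have key : ∀ (Δ : Ctx Var F.M) (Ω : State (T.trCtx Δ)),
      Ω ∈ IVL.Assn.ex x (T.trTy t) B' (T.trCtx Δ) ↔
      ∃ (v₀ : F.M.Val) (_ : F.M.hasTy v₀ t) (hv : V.M.hasTy (T.trVal v₀) (T.trTy t)),
        updTr Ω x hv ∈ A' (T.trCtx (Δ.set x t)) := by
    intro Δ Ω
    rw [mem_ex_trCtx]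
    constructor
    · rintro ⟨v, hv, h⟩
      obtain ⟨h', v₀, h₀, rfl⟩ := (hB _ _ v (by simp [updTr]) hv).1 h
      exact ⟨v₀, (F.hasTy_iff _ _).2 h₀, hv, h'⟩
    · rintro ⟨v₀, h₀, hv, h⟩
      exact ⟨_, hv, (hB _ _ _ (by simp [updTr]) hv).2 ⟨h, v₀, (F.hasTy_iff _ _).1 h₀, rfl⟩⟩
  refine ⟨fun Δ ω Ω hr => ?_, fun Δ Ω hΩ Ω' hge => ?_, fun Δ ω Ω ΩA ΩF hr h hΩ => ?_⟩
  · rw [key, mem_existsVar]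
    constructor
    · rintro ⟨v₀, h₀, h⟩
      have hv := hT.trVal_typed _ _ ((F.hasTy_iff _ _).1 h₀)
      exact ⟨v₀, h₀, hv, (hA.sem _ _ _ (relS_upd hr x h₀ hv)).1 h⟩
    · rintro ⟨v₀, h₀, hv, h⟩
      exact ⟨v₀, h₀, (hA.sem _ _ _ (relS_upd hr x h₀ hv)).2 h⟩
  · rw [key] at hΩ ⊢
    obtain ⟨v₀, h₀, hv, h⟩ := hΩ
    obtain ⟨h₁, h₂⟩ := State.ge_iff.1 hge
    exact ⟨v₀, h₀, hv, hA.mono _ _ h _ (State.ge_iff.2 ⟨by simp only [updTr, h₁], h₂⟩)⟩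
  · rw [key] at hΩ
    obtain ⟨v₀, h₀, hv, hm⟩ := hΩ
    obtain ⟨s₁, s₂, hh⟩ := State.oplus_iff.1 h
    obtain ⟨ω₁, ω₂, Ω₂, e, m, r, hge⟩ := hA.gbs _ _ _ (updTr ΩA x hv) (updTr ΩF x hv)
      (relS_upd hr x h₀ hv)
      (State.oplus_iff.2 ⟨by simp only [updTr, s₁], by simp only [updTr, s₂], hh⟩) hm
    obtain ⟨s₃, s₄, hh'⟩ := State.oplus_iff.1 e
    -- The split was found with `x` overwritten by the witness. Only its heaps are kept; the
    -- original stores are put back.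
    refine ⟨ω.withHeap ω₁.heap, ω.withHeap ω₂.heap, ΩF.withHeap Ω₂.heap,
      State.oplus_iff.2 ⟨rfl, rfl, hh'⟩, mem_existsVar.2 ⟨v₀, h₀, ?_⟩,
      ⟨s₂.trans hr.1, r.2⟩, State.ge_iff.2 ⟨rfl, (State.ge_iff.1 hge).2⟩⟩
    convert m
    exact State.ext s₃.symm rfl

theorem Encodes.trAssn (hT : T.Requirements) (A : F.Assn) : T.Encodes A.sat (T.trAssn A) := by
  induction A with
  | inp a => exact .inp hT a
  | bool b => exact .evalsTo hT b true
  | sep A B hA hB => exact hA.sep hB hT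
  | or A B hA hB => exact hA.or hB
  | imp b A hA => exact hA.imp hT b
  | ex x t A hA =>
    refine hA.ex_aux hT fun Δ Ω v hx hv => ?_
    generalize hn : T.haveInv t = o
    cases o with
    | none => exact ⟨fun h => ⟨h, hT.haveInv_none t hn v hv⟩, fun h => h.1⟩
    | some e =>
      rw [← hT.haveInv_some t e hn x _ Ω v hx hv]
      -- Conjoining a pure, monotone expression to a monotone assertion is intersection.
      change Ω ∈ sepConj (SLTrans.evalsTo (e x).eval true) _ ↔ _
      rw [sepConj_comm, sepConj_evalsTo (hA.mono Δ)]
      rfl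

/-! ## Soundness of the statement translation -/

theorem Requirements.independent_sat (hT : T.Requirements) (A : F.Assn) {x : Var}
    (hx : x ∉ A.fv) : Independent (A.sat Δ) x := by
  have hbe : ∀ (Δ : Ctx Var F.M) (b : F.BE), x ∉ F.fvBE b → ∀ ω ω' : State Δ,
      AgreeOff x ω ω' → F.evalBE b ω = F.evalBE b ω' := by
    intro Δ b hb ω ω' h
    rcases h.eq_or_isUpd with rfl | ⟨v, hv⟩
    exacts [rfl, hT.be_fv b Δ x hb _ _ v hv]
  induction A generalizing Δ with
  | inp a => exact hT.inp_fv a Δ x hx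
  | bool b =>
    exact independent_iff.2 fun ω ω' h hω => (hbe Δ b hx ω ω' h).symm.trans hω
  | sep A B hA hB =>
    rw [FrontEnd.Assn.fv, Finset.notMem_union] at hx
    exact (hA hx.1).sepConj (hB hx.2)
  | or A B hA hB =>
    rw [FrontEnd.Assn.fv, Finset.notMem_union] at hx
    exact (hA hx.1).union (hB hx.2)
  | imp b A hA =>
    rw [FrontEnd.Assn.fv, Finset.notMem_union] at hx
    refine independent_iff.2 fun ω ω' h ⟨h₁, h₂⟩ => ?_
    rw [hbe Δ b hx.1 ω ω' h] at h₁ h₂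
    exact ⟨h₁, fun ht => independent_iff.1 (hA hx.2) ω ω' h (h₂ ht)⟩
  | ex y t A hA =>
    rw [FrontEnd.Assn.fv, Finset.mem_erase, not_and_or, not_not] at hx
    rcases hx with rfl | hx
    exacts [independent_existsVar_self _ _, (hA hx).existsVar]

theorem Requirements.inhalesMonotone (hT : T.Requirements) (c : F.Stmt) :
    (T.trStmt c).1.InhalesMonotone (T.trCtx Δ) := by
  induction c with
  | skip => trivial
  | prim c => exact hT.trPrim_inhale c Δ
  | seq c₁ c₂ h₁ h₂ => exact ⟨h₁, h₂⟩
  | ite b c₁ c₂ h₁ h₂ => exact ⟨h₁, h₂⟩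
  | par P₁ c₁ Q₁ P₂ c₂ Q₂ _ _ =>
    exact ⟨trivial, IVL.Stmt.inhalesMonotone_havocs _, (Encodes.trAssn hT (.sep Q₁ Q₂)).mono Δ⟩
  | _ b I c _ =>
    exact ⟨trivial, IVL.Stmt.inhalesMonotone_havocs _,
      ((Encodes.trAssn hT I).mono Δ).sepConj_left _⟩

/-- Soundness of `exhale A'; havoc xs; inhale B'` for a statement with precondition `A` and
postcondition `B` that writes only variables among `xs`. -/
theorem Requirements.csl_of_exhale_havocs_inhale (hT : T.Requirements) {c : F.Stmt}
    {A B : ∀ Δ : Ctx Var F.M, Set (State Δ)} {A' B' : V.Assn}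
    (hA : T.Encodes A A') (hB : T.Encodes B B') (hc : F.CSL Δ (A Δ) c (B Δ))
    {xs : List Var} (hxs : ∀ x ∈ c.wr, x ∈ xs) {P Q : Set (State (T.trCtx Δ))}
    (h : V.Ax (T.trCtx Δ) P (.seq (.exhale A') (.seq (.havocs xs) (.inhale B'))) Q) :
    F.CSL Δ (T.btr P) c (T.btr Q) := by
  obtain ⟨R, h₁, h⟩ := h.seq_inv
  obtain ⟨R', h₂, h₃⟩ := h.seq_inv
  obtain ⟨hP, hPR, -⟩ := h₁.exhale_inv
  obtain ⟨hR', hfr, rfl⟩ := h₃.inhale_inv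
  obtain ⟨hRR', hind, -⟩ := h₂.havocs
  -- The frame comes from the closure of `R'`, the assertion after the havocs. The closure is needed
  -- because backward satisfiability encodes the remainder only by some larger IVL state.
  refine .conseq _ _ _ _ _ (.frame _ _ (T.btr (monotonize R')) _ hc
    (hT.selfFraming_btr hR'.monotonize) fun x hx => hT.independent_btr ?_) ?_ ?_
    (hT.selfFraming_btr hP) (hT.selfFraming_btr (hR'.sepConj_of_frames (hB.mono Δ) hfr))
  · refine independent_iff.2 ?_
    rintro a b hab ⟨d, hd, hda⟩
    obtain ⟨e₁, e₂⟩ := State.ge_iff.1 hda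
    refine ⟨b.withHeap d.heap, independent_iff.1 (hind x (hxs x hx)) d _ ⟨fun y hy => ?_, rfl⟩ hd,
      State.ge_iff.2 ⟨rfl, hab.2 ▸ e₂⟩⟩
    rw [e₁]
    exact hab.1 y hy
  -- Precondition: split the exhaled part off `ω`; the rest lies in the frame because havocs only
  -- enlarge `R`.
  · rintro ω ⟨Ω, hΩ, hr⟩
    obtain ⟨ΩR, hΩR, ΩA, hΩA, e⟩ := hPR hΩ
    obtain ⟨ωA, ωF, ΩF', e', m, r, hge⟩ := hA.gbs Δ ω Ω ΩA ΩR hr (oplus_swap e) hΩA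
    exact ⟨ωA, m, ωF, ⟨ΩF', ⟨ΩR, hRR' hΩR, hge⟩, r⟩, e'⟩
  -- Postcondition: the encoding of the frame is given, and one of `ω₁` is chosen compatibly. Any
  -- encoding of `ω₁` satisfies `B'`.
  · rintro ω ⟨ω₁, h₁, ω₂, ⟨Ω₂, h₂, r₂⟩, e⟩
    obtain ⟨Ω₁, Ω, r₁, e', r⟩ := hT.relS_extend r₂ (oplus_swap e)
    refine ⟨Ω, ?_, r⟩
    rw [← ((hB.mono Δ).sepConj_right R').monotonize_eq, ← sepConj_monotonize]
    exact ⟨Ω₂, h₂, Ω₁, (hB.sem _ _ _ r₁).1 h₁, e'⟩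

/-- Soundness for `inhale A'; C; exhale B'`. -/
theorem Requirements.csl_of_inhale_exhale (hT : T.Requirements) {c : F.Stmt}
    {A B : ∀ Δ : Ctx Var F.M, Set (State Δ)} {A' B' : V.Assn}
    (hA : T.Encodes A A') (hB : T.Encodes B B') (hAs : SelfFraming (A Δ))
    (hBs : SelfFraming (B Δ))
    (ih : ∀ P Q : Set (State (T.trCtx Δ)), IsMonotone P → IsMonotone Q →
      V.Ax (T.trCtx Δ) P (T.trStmt c).1 Q → F.CSL Δ (T.btr P) c (T.btr Q))
    {QC : Set (State (T.trCtx Δ))}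
    (h : V.Ax (T.trCtx Δ) Set.univ (.seq (.inhale A') (.seq (T.trStmt c).1 (.exhale B'))) QC) :
    F.CSL Δ (A Δ) c (B Δ) := by
  obtain ⟨R₁, h₁, h⟩ := h.seq_inv
  obtain ⟨R₂, h₂, h₃⟩ := h.seq_inv
  obtain ⟨-, -, rfl⟩ := h₁.inhale_inv
  obtain ⟨-, hsub, -⟩ := h₃.exhale_inv
  rw [(hA.mono Δ).univ_sepConj] at h₂
  have h₄ := h₂.monotonize (hT.inhalesMonotone c)
  rw [(hA.mono Δ).monotonize_eq] at h₄
  have h₅ := ih _ _ (hA.mono Δ) (isMonotone_monotonize _) h₄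
  rw [hA.btr_eq hT] at h₅
  refine .conseq _ _ _ _ _ h₅ subset_rfl ?_ hAs hBs
  rw [← hB.btr_eq hT]
  -- Whatever remains after the exhale is absorbed into the monotone `B'`.
  refine btr_mono ((hB.mono Δ).monotonize_subset (hsub.trans ?_))
  rintro x ⟨a, -, b, hb, e⟩
  exact hB.mono Δ b hb x (ge_right e)

/-- Stated for arbitrary monotone assertions, since the intermediate assertions of an IVL proof need
not be translations of front-end assertions. -/
theorem Requirements.csl_btr (hT : T.Requirements) (c : F.Stmt) (hwf : c.WF Δ)
    (hC : ∀ C ∈ (T.trStmt c).2, ∃ QC, V.Ax (T.trCtx Δ) Set.univ C QC)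
    (P Q : Set (State (T.trCtx Δ))) (hP : IsMonotone P) (hQ : IsMonotone Q)
    (h : V.Ax (T.trCtx Δ) P (T.trStmt c).1 Q) : F.CSL Δ (T.btr P) c (T.btr Q) := by
  induction c generalizing P Q with
  | skip =>
    obtain ⟨hs, rfl⟩ := IVL.Ax.skip_inv h
    exact .skip _ (hT.selfFraming_btr hs)
  | prim c => exact hT.trPrim_sem c Δ P Q hP hQ h
  | seq c₁ c₂ ih₁ ih₂ =>
    obtain ⟨R, h₁, h₂⟩ := IVL.Ax.seq_inv h
    have h₁ := h₁.monotonize (hT.inhalesMonotone c₁)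
    have h₂ := h₂.monotonize (hT.inhalesMonotone c₂)
    rw [hP.monotonize_eq] at h₁
    rw [hQ.monotonize_eq] at h₂
    exact .seq _ _ _ _ _
      (ih₁ hwf.1 (fun C hC' => hC C (.inl hC')) _ _ hP (isMonotone_monotonize R) h₁)
      (ih₂ hwf.2 (fun C hC' => hC C (.inr hC')) _ _ (isMonotone_monotonize R) hQ h₂)
  | ite b c₁ c₂ ih₁ ih₂ =>
    obtain ⟨B₁, B₂, rfl, hb, h₁, h₂⟩ := IVL.Ax.ite_inv h
    have h₁ := h₁.monotonize (hT.inhalesMonotone c₁)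
    have h₂ := h₂.monotonize (hT.inhalesMonotone c₂)
    rw [(hP.sepConj_left _).monotonize_eq] at h₁ h₂
    -- The branch postconditions need not be monotone, but their union is; so closing each of them
    -- does not change it.
    rw [← hQ.monotonize_eq, monotonize_union, btr_union]
    have i₁ := ih₁ hwf.1 (fun C hC' => hC C (.inl hC')) _ _ (hP.sepConj_left _)
      (isMonotone_monotonize B₁) h₁
    have i₂ := ih₂ hwf.2 (fun C hC' => hC C (.inr hC')) _ _ (hP.sepConj_left _)
      (isMonotone_monotonize B₂) h₂
    rw [sepConj_evalsTo hP, hT.btr_inter_evalsTo] at i₁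
    rw [IVL.BExp.evalsTo_not, sepConj_evalsTo hP, hT.btr_inter_evalsTo] at i₂
    exact .ite _ _ _ _ _ _ (hT.framesExpr_btr hb) i₁ i₂
  | par P₁ c₁ Q₁ P₂ c₂ Q₂ ih₁ ih₂ =>
    obtain ⟨w₁, w₂, hP₁, hQ₁, hP₂, hQ₂, d₁, d₂⟩ := hwf
    obtain ⟨QC₁, hQC₁⟩ := hC _ (.inl (.inl (.inl rfl)))
    obtain ⟨QC₂, hQC₂⟩ := hC _ (.inl (.inl (.inr rfl)))
    have t₁ := hT.csl_of_inhale_exhale (.trAssn hT P₁) (.trAssn hT Q₁) hP₁ hQ₁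
      (ih₁ w₁ fun C hC' => hC C (.inl (.inr hC'))) hQC₁
    have t₂ := hT.csl_of_inhale_exhale (.trAssn hT P₂) (.trAssn hT Q₂) hP₂ hQ₂
      (ih₂ w₂ fun C hC' => hC C (.inr hC')) hQC₂
    -- The side conditions of well-formedness yield those of the parallel rule: independence of an
    -- annotation follows from disjointness from its free variables.
    rw [← Finset.disjoint_iff_inter_eq_empty, Finset.disjoint_union_right,
      Finset.disjoint_union_right] at d₁ d₂
    refine hT.csl_of_exhale_havocs_inhale (.trAssn hT (.sep P₁ P₂)) (.trAssn hT (.sep Q₁ Q₂))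
      (.par _ _ _ _ _ _ _ _ _ _ t₁ t₂ (Finset.disjoint_iff_inter_eq_empty.1 d₂.1.1.symm)
        (Finset.disjoint_iff_inter_eq_empty.1 d₁.1.1.symm)
        (fun x hx => ⟨hT.independent_sat _ ?_, hT.independent_sat _ ?_⟩)
        (fun x hx => ⟨hT.independent_sat _ ?_, hT.independent_sat _ ?_⟩))
      (fun x hx => Finset.mem_toList.2 hx) h
    exacts [Finset.disjoint_left.1 d₂.1.2 hx, Finset.disjoint_left.1 d₂.2 hx,
      Finset.disjoint_left.1 d₁.1.2 hx, Finset.disjoint_left.1 d₁.2 hx]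
  | _ b I c ih =>
    obtain ⟨hwc, hI, hst⟩ := hwf
    have eI := Encodes.trAssn hT I
    have eT := Encodes.evalsTo hT b true
    have eN : T.Encodes (fun _ => evalsTo (F.evalBE b) false) (.bool (T.trBE b).not) := by
      have h := Encodes.evalsTo hT b false
      simp only [← IVL.BExp.evalsTo_not] at h
      exact h
    have eD : T.Encodes _ (defd (T.trBE b)) := eT.or eN
    have hmI : IsMonotone (I.sat Δ) := eI.isMonotone_front hT
    have hsep : ∀ d, sepConj (I.sat Δ) (evalsTo (F.evalBE b) d) =
        I.sat Δ ∩ evalsTo (F.evalBE b) d := fun d =>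
      hmI.sepConj_eq_inter ((hT.isMonotoneExpr b).evalsTo d)
        fun _ => (hT.be_pure b Δ).core_mem_evalsTo
    have hsepD : sepConj (I.sat Δ) (evalsTo (F.evalBE b) true ∪ evalsTo (F.evalBE b) false) =
        I.sat Δ ∩ (evalsTo (F.evalBE b) true ∪ evalsTo (F.evalBE b) false) := by
      refine hmI.sepConj_eq_inter (((hT.isMonotoneExpr b).evalsTo _).union
        ((hT.isMonotoneExpr b).evalsTo _)) ?_
      rintro x (hx | hx)
      exacts [.inl ((hT.be_pure b Δ).core_mem_evalsTo hx),
        .inr ((hT.be_pure b Δ).core_mem_evalsTo hx)]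
    -- The while rule requires its invariant to frame `b`, which `I` alone need not do. So the CSL
    -- invariant is `J`, that is `I` together with definedness of `b`; it is self-framing because
    -- `b` is stable under `I`.
    set J := I.sat Δ ∩ (evalsTo (F.evalBE b) true ∪ evalsTo (F.evalBE b) false) with hJ
    have hJb : ∀ d, J ∩ evalsTo (F.evalBE b) d = I.sat Δ ∩ evalsTo (F.evalBE b) d := by
      intro d
      rw [hJ, Set.inter_assoc]
      congr 1
      refine Set.inter_eq_right.2 ?_
      cases d
      exacts [Set.subset_union_right, Set.subset_union_left]
    obtain ⟨QC, hQC⟩ := hC _ (.inl rfl)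
    have hbody : F.CSL Δ (J ∩ evalsTo (F.evalBE b) true) c J := by
      have := hT.csl_of_inhale_exhale (eI.sep eT hT) (eI.sep eD hT)
        (by rw [hsep]; exact StableUnder.selfFraming_inter hst hI {some true})
        (by rw [hsepD]; exact StableUnder.selfFraming_inter hst hI {some true, some false})
        (ih hwc fun C hC' => hC C (.inr hC')) hQC
      rwa [hsep, hsepD, ← hJb] at this
    refine hT.csl_of_exhale_havocs_inhale (eI.sep eD hT) (eI.sep eN hT) ?_
      (fun x hx => Finset.mem_toList.2 hx) h
    rw [hsep, hsepD, ← hJb]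
    refine .while _ _ _ _ ?_ (fun x hx => hst x hx.1) hbody
    rintro x ⟨-, hx | hx⟩ <;> rw [show F.evalBE b x = _ from hx] <;> rfl

end Translation

end SLTrans

/-! ### The theorem. -/

theorem mainTheorem2 {Var : Type w} [DecidableEq Var] (F : FrontEnd.{u, w} Var)
    (V : IVL.{v, w} Var) (T : Translation F V) (hT : T.Requirements) :
    (∀ (A : F.Assn) (Δ : Ctx Var F.M),
      T.WellFormed (Δ := Δ) (T.trAssn A (T.trCtx Δ))) ∧
    (∀ (Δ : Ctx Var F.M) (c : F.Stmt) (P Q : F.Assn), c.WF Δ →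
      V.Ax (T.trCtx Δ) (T.trAssn P (T.trCtx Δ)) (T.trStmt c).1 (T.trAssn Q (T.trCtx Δ)) →
      (∀ C ∈ (T.trStmt c).2, ∃ QC, V.Ax (T.trCtx Δ) Set.univ C QC) →
      F.CSL Δ (P.sat Δ) c (Q.sat Δ)) := by
  have h := Translation.Encodes.trAssn hT
  refine ⟨fun A Δ => (h A).wellFormed hT, fun Δ c P Q hwf hax hC => ?_⟩
  have := hT.csl_btr c hwf hC _ _ ((h P).mono Δ) ((h Q).mono Δ) hax
  rwa [(h P).btr_eq hT, (h Q).btr_eq hT] at this
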